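/- Let $n$ be a positive integer, and put $$J_{2n}=\begin{bmatrix}0&-I_n\\ I_n&0\end{bmatrix},\qquad I_{n,n}=\begin{bmatrix}I_n&0\\0&-I_n\end{bmatrix},\qquad X^{\mathsf L}=I_{n,n}X^{\mathsf H}I_{n,n}\quad(X\in\mathbb{C}^{2n\times 2n}),$$ where $X^{\mathsf H}$ is the conjugate transpose. Let $\mathrm{Sp}(n)=\mathrm{U}(2n)\cap \mathrm{Sp}(2n,\mathbb{C})$ be the compact symplectic group, where $\mathrm{Sp}(2n,\mathbb{C})=\{Q\in\mathbb{C}^{2n\times 2n}: Q^{\mathsf T}J_{2n}Q=J_{2n}\}$, with its smooth structure as an embedded submanifold of $\mathbb{C}^{2n\times 2n}$. Regard $\mathrm{U}(n)$ as the subgroup $\{\operatorname{diag}(A,\overline{A}):A\in \mathrm{U}(n)\}$ of $\mathrm{Sp}(n)$, and give $\mathrm{Sp}(n)/\mathrm{U}(n)$ the quotient topology and the smooth structure for which the projection $\mathrm{Sp}(n)\to\mathrm{Sp}(n)/\mathrm{U}(n)$, $Q\mapsto[Q]$, is a smooth submersion. Let $\mathrm{LGr}(\mathbb{C}^{2n})$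 be the set of Lagrangian complex subspaces of $\mathbb{C}^{2n}$ with respect to the complex symplectic form $\omega(v,w)=v^{\mathsf T}J_{2n}w$, with its standard structure of a real smooth manifold, for which all the maps $S\mapsto A\{(x,Sx):x\in\mathbb{C}^n\}$, $A\in\mathrm{Sp}(2n,\mathbb{C})$, from the space of complex symmetric $n\times n$ matrices to $\mathrm{LGr}(\mathbb{C}^{2n})$ are local diffeomorphisms. Let $\mathsf{V}^2(\mathbb{C}^{2n})=\{X\in\mathbb{C}^{2n\times 2n}:X=X^{\mathsf L}\}$. Then these smooth structures exist, $\{QQ^{\mathsf L}:Q\in\mathrm{Sp}(n)\}$ is an embedded smooth submanifold of $\mathbb{C}^{2n\times 2n}$, and there are $\mathrm{Sp}(n)$-equivariant diffeomorphisms of real manifolds of dimension $n(n+1)$ $$\mathrm{LGr}(\mathbb{C}^{2n})\;\cong\;\mathrm{Sp}(n)/\mathrm{U}(n)\;\cong\;\{QQ^{\mathsf L}:Q\in \mathrm{Sp}(n)\},$$ the first given by $Q(\mathbb{C}^n\times\{0\})\mapsto[Q]$ and the second by $[Q]\mapsto QQ^{\mathsf L}$; here $A\in\mathrm{Sp}(n)$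 acts on the three spaces by $L\mapsto AL$, $[Q]\mapsto[AQ]$ and $X\mapsto AXA^{\mathsf L}$, respectively. Moreover, $$\{QQ^{\mathsf L}:Q\in \mathrm{Sp}(n)\}=\mathrm{Sp}(n)\cap\mathsf{V}^2(\mathbb{C}^{2n})=\{X\in\mathrm{Sp}(n):X=X^{\mathsf L}\}.$$ -/

import Mathlib

open scoped ContDiff Manifold Matrix

noncomputable section

namespace ComplexLagrangian

/-- Complex `2n × 2n` matrices, written in `n × n` blocks. -/
abbrev BlockMat (n : ℕ) : Type := Matrix (Fin n ⊕ Fin n) (Fin n ⊕ Fin n) ℂ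

/-- The compact symplectic group `Sp(n) = U(2n) ∩ Sp(2n, ℂ)`. -/
def Sp (n : ℕ) : Submonoid (BlockMat n) :=
  Matrix.unitaryGroup (Fin n ⊕ Fin n) ℂ ⊓ Matrix.symplecticGroup (Fin n) ℂ

theorem conjTranspose_mem_Sp {n : ℕ} {Q : BlockMat n} (hQ : Q ∈ Sp n) : Qᴴ ∈ Sp n := by
  refine ⟨Unitary.star_mem hQ.1, ?_⟩
  have h1 : Q⁻¹ = Qᴴ := Matrix.inv_eq_left_inv (Matrix.mem_unitaryGroup_iff'.1 hQ.1)
  have h2 := ((⟨Q, hQ.2⟩ : Matrix.symplecticGroup (Fin n) ℂ)⁻¹).2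
  rwa [SymplecticGroup.coe_inv', h1] at h2

instance (n : ℕ) : Group (Sp n) :=
  { (inferInstance : Monoid (Sp n)) with
    inv := fun Q => ⟨(Q : BlockMat n)ᴴ, conjTranspose_mem_Sp Q.2⟩
    inv_mul_cancel := fun Q => Subtype.ext (Matrix.mem_unitaryGroup_iff'.1 Q.2.1) }

/-- The space of `2n × 2n` arrays of complex numbers, a normed space with the usual topology. -/
abbrev Entries (n : ℕ) : Type := Fin n ⊕ Fin n → Fin n ⊕ Fin n → ℂ

/-- The entries of a matrix. -/
def entries {n : ℕ} (X : BlockMat n) : Entries n := Matrix.of.symm X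

/-- An element of `Sp(n)` as an element of `Sp(2n, ℂ)`. -/
def toSymplectic {n : ℕ} (Q : Sp n) : Matrix.symplecticGroup (Fin n) ℂ := ⟨Q, Q.2.2⟩

theorem fromBlocks_mem_Sp {n : ℕ} (A : Matrix.unitaryGroup (Fin n) ℂ) :
    (Matrix.fromBlocks (A : Matrix (Fin n) (Fin n) ℂ) 0 0
      ((A : Matrix (Fin n) (Fin n) ℂ).map star) : BlockMat n) ∈ Sp n := by
  have h1 : (A : Matrix (Fin n) (Fin n) ℂ) * (A : Matrix (Fin n) (Fin n) ℂ)ᴴ = 1 :=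
    Matrix.mem_unitaryGroup_iff.1 A.2
  have h2 : (A : Matrix (Fin n) (Fin n) ℂ).map star * (A : Matrix (Fin n) (Fin n) ℂ)ᵀ = 1 := by
    have h := congrArg (fun M : Matrix (Fin n) (Fin n) ℂ => M.map (starRingEnd ℂ)) h1
    simp only [Matrix.map_mul] at h
    rw [Matrix.map_one _ (map_zero _) (map_one _)] at h
    have h' : (A : Matrix (Fin n) (Fin n) ℂ)ᵀ =
        (A : Matrix (Fin n) (Fin n) ℂ)ᴴ.map (starRingEnd ℂ) := by
      ext i j
      simp
    rw [h']
    exact h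
  have h3 : ((A : Matrix (Fin n) (Fin n) ℂ).map star)ᵀ = (A : Matrix (Fin n) (Fin n) ℂ)ᴴ := rfl
  have h4 : ((A : Matrix (Fin n) (Fin n) ℂ).map star)ᴴ = (A : Matrix (Fin n) (Fin n) ℂ)ᵀ := by
    ext i j
    simp
  refine ⟨?_, ?_⟩
  · change _ ∈ Matrix.unitaryGroup (Fin n ⊕ Fin n) ℂ
    rw [Matrix.mem_unitaryGroup_iff, Matrix.star_eq_conjTranspose, Matrix.fromBlocks_conjTranspose,
      Matrix.fromBlocks_multiply, h4, h1, h2]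
    simp
  · change _ ∈ Matrix.symplecticGroup (Fin n) ℂ
    rw [SymplecticGroup.mem_iff, Matrix.J, Matrix.fromBlocks_transpose,
      Matrix.fromBlocks_multiply, Matrix.fromBlocks_multiply, h3]
    simp only [Matrix.mul_zero, Matrix.zero_mul, Matrix.mul_neg, Matrix.neg_mul, Matrix.mul_one,
      Matrix.transpose_zero, add_zero, zero_add, neg_zero, h1, h2]

/-- The embedding `U(n) → Sp(n)`, `A ↦ diag(A, Ā)`. -/
def unitaryEmbedding (n : ℕ) : Matrix.unitaryGroup (Fin n) ℂ →* Sp n where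
  toFun A := ⟨Matrix.fromBlocks (A : Matrix (Fin n) (Fin n) ℂ) 0 0
    ((A : Matrix (Fin n) (Fin n) ℂ).map star), fromBlocks_mem_Sp A⟩
  map_one' := by
    apply Subtype.ext
    simp
  map_mul' A B := by
    apply Subtype.ext
    change _ = (_ : BlockMat n) * (_ : BlockMat n)
    rw [Matrix.fromBlocks_multiply]
    simp

/-- `U(n)` as a subgroup of `Sp(n)`. -/
def U (n : ℕ) : Subgroup (Sp n) := (unitaryEmbedding n).range

/-- `I_{n,n} = diag(I_n, -I_n)`. -/
def Inn (n : ℕ) : BlockMat n := Matrix.fromBlocks 1 0 0 (-1)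

/-- The Lagrangian adjoint `X^L = I_{n,n} X^H I_{n,n}`. -/
def lagAdj {n : ℕ} (X : BlockMat n) : BlockMat n := Inn n * Xᴴ * Inn n

/-- The real vector space `V²(ℂ²ⁿ)` of Lagrangian symmetric matrices. -/
def V2 (n : ℕ) : Submodule ℝ (BlockMat n) where
  carrier := {X | X = lagAdj X}
  zero_mem' := by simp [lagAdj]
  add_mem' {X Y} hX hY := by
    change X + Y = lagAdj (X + Y)
    simp only [lagAdj, Matrix.conjTranspose_add, Matrix.mul_add, Matrix.add_mul]
    exact congrArg₂ (· + ·) hX hY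
  smul_mem' c X hX := by
    change c • X = lagAdj (c • X)
    simp only [lagAdj, Matrix.conjTranspose_smul, star_trivial, Matrix.mul_smul, Matrix.smul_mul]
    exact congrArg (c • ·) hX

/-- The set `{Q Q^L : Q ∈ Sp(n)}`. -/
def QQL (n : ℕ) : Set (BlockMat n) := {X | ∃ Q ∈ Sp n, X = Q * lagAdj Q}

/-- The standard complex symplectic form `ω(v, w) = vᵀ J w` on `ℂ²ⁿ`. -/
def omega (n : ℕ) : LinearMap.BilinForm ℂ (Fin n ⊕ Fin n → ℂ) :=
  Matrix.toBilin' (Matrix.J (Fin n) ℂ)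

/-- The Lagrangian Grassmannian `LGr(ℂ²ⁿ)`: the complex subspaces `L` of `ℂ²ⁿ` that equal their
orthogonal complement with respect to the standard complex symplectic form. -/
def LGr (n : ℕ) : Type :=
  {L : Submodule ℂ (Fin n ⊕ Fin n → ℂ) // (omega n).orthogonal L = L}

theorem omega_mulVec {n : ℕ} (A : Matrix.symplecticGroup (Fin n) ℂ) (v w : Fin n ⊕ Fin n → ℂ) :
    omega n ((A : BlockMat n) *ᵥ v) ((A : BlockMat n) *ᵥ w) = omega n v w := by
  have h : (A : BlockMat n)ᵀ * Matrix.J (Fin n) ℂ * (A : BlockMat n) = Matrix.J (Fin n) ℂ :=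
    SymplecticGroup.mem_iff'.1 A.2
  simp only [omega, Matrix.toBilin'_apply']
  conv_rhs => rw [← h, ← Matrix.mulVec_mulVec, ← Matrix.mulVec_mulVec, Matrix.dotProduct_mulVec,
    Matrix.vecMul_transpose]

/-- The action `(A, L) ↦ A L` of `Sp(2n, ℂ)` on Lagrangian subspaces. -/
def LGr.act {n : ℕ} (A : Matrix.symplecticGroup (Fin n) ℂ) (L : LGr n) : LGr n :=
  ⟨L.1.map (Matrix.toLin' (A : BlockMat n)), by
    have hinv : ∀ v : Fin n ⊕ Fin n → ℂ,
        (A : BlockMat n) *ᵥ (((A⁻¹ : Matrix.symplecticGroup (Fin n) ℂ) : BlockMat n) *ᵥ v) = v := by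
      intro v
      have h : (A : BlockMat n) * ((A⁻¹ : Matrix.symplecticGroup (Fin n) ℂ) : BlockMat n) = 1 :=
        congrArg Subtype.val (mul_inv_cancel A)
      rw [Matrix.mulVec_mulVec, h, Matrix.one_mulVec]
    ext m
    rw [LinearMap.BilinForm.mem_orthogonal_iff]
    constructor
    · intro h
      refine ⟨_, ?_, hinv m⟩
      rw [← L.2]
      change _ ∈ (omega n).orthogonal L.1
      rw [LinearMap.BilinForm.mem_orthogonal_iff]
      intro w hw
      have h' := h _ ⟨w, hw, rfl⟩
      rw [← omega_mulVec A, hinv]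
      exact h'
    · rintro ⟨v, hv, rfl⟩ _ ⟨w, hw, rfl⟩
      rw [Matrix.toLin'_apply, Matrix.toLin'_apply, omega_mulVec]
      have hv' : v ∈ (omega n).orthogonal L.1 := by rw [L.2]; exact hv
      exact (LinearMap.BilinForm.mem_orthogonal_iff.1 hv') w hw⟩

/-- The real vector space of complex symmetric `n × n` matrices, given by their entries. -/
def Sym (n : ℕ) : Submodule ℝ (Fin n → Fin n → ℂ) where
  carrier := {S | ∀ i j, S i j = S j i}
  zero_mem' := fun _ _ => rfl
  add_mem' {S T} hS hT i j := by
    simp only [Pi.add_apply, hS i j, hT i j]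
  smul_mem' c S hS i j := by
    simp only [Pi.smul_apply, hS i j]

/-- An element of `Sym n` as a matrix. -/
def Sym.toMatrix {n : ℕ} (S : Sym n) : Matrix (Fin n) (Fin n) ℂ := Matrix.of S.1

/-- The Lagrangian subspace `{(x, S x) : x ∈ ℂⁿ}` for a complex symmetric matrix `S`. -/
def LGr.graph {n : ℕ} (S : Sym n) : LGr n :=
  ⟨LinearMap.range (Matrix.toLin' (Matrix.fromRows 1 (Sym.toMatrix S))), by
    have hS : (Sym.toMatrix S)ᵀ = Sym.toMatrix S := by
      ext i j
      exact S.2 j i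
    ext m
    rw [LinearMap.BilinForm.mem_orthogonal_iff]
    have key : ∀ x : Fin n → ℂ, omega n (Sum.elim x ((Sym.toMatrix S) *ᵥ x)) m =
        x ⬝ᵥ ((Sym.toMatrix S) *ᵥ (m ∘ Sum.inl) - m ∘ Sum.inr) := by
      intro x
      rw [omega, Matrix.toBilin'_apply', Matrix.J, Matrix.fromBlocks_mulVec,
        sumElim_dotProduct_sumElim]
      rw [dotProduct_sub, Matrix.dotProduct_mulVec x, ← Matrix.mulVec_transpose, hS]
      simp [Matrix.neg_mulVec]
      ring
    constructor
    · intro h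
      refine ⟨m ∘ Sum.inl, ?_⟩
      have h0 : (Sym.toMatrix S) *ᵥ (m ∘ Sum.inl) - m ∘ Sum.inr = 0 := by
        apply dotProduct_eq_zero
        intro x
        rw [dotProduct_comm, ← key]
        refine h _ ⟨x, ?_⟩
        rw [Matrix.toLin'_apply, Matrix.fromRows_mulVec, Matrix.one_mulVec]
      rw [Matrix.toLin'_apply, Matrix.fromRows_mulVec, Matrix.one_mulVec, sub_eq_zero.1 h0]
      exact Sum.elim_comp_inl_inr m
    · rintro ⟨y, rfl⟩ _ ⟨x, rfl⟩
      simp only [Matrix.toLin'_apply, Matrix.fromRows_mulVec, Matrix.one_mulVec] at key ⊢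
      rw [key]
      simp⟩

/-- The affine parametrization `S ↦ A {(x, S x) : x ∈ ℂⁿ}` of the Lagrangian subspaces that are
transversal to the Lagrangian subspace `A ({0} × ℂⁿ)`. -/
def LGr.param {n : ℕ} (A : Matrix.symplecticGroup (Fin n) ℂ) (S : Sym n) : LGr n :=
  LGr.act A (LGr.graph S)

/-- The manifold topology: a set is open if and only if its preimage under every
affine parametrization is open. -/
instance (n : ℕ) : TopologicalSpace (LGr n) :=
  ⨆ A : Matrix.symplecticGroup (Fin n) ℂ, TopologicalSpace.coinduced (LGr.param A) inferInstance

/-- The coordinate Lagrangian subspace `ℂⁿ × {0}`. -/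
def LGr.std (n : ℕ) : LGr n := LGr.graph 0

end ComplexLagrangian

end

/-!
With the involution `σ Q = I_{n,n} Q I_{n,n}` one has `Q Q^L = Q (σ Q)⁻¹`, so that `[Q] ↦ Q Q^L` is
the Cartan embedding of the symmetric space `Sp(n)/U(n)`. The Cayley transform `(1 - Z) (1 + Z)⁻¹`
straightens `Sp(n)` and `{Q Q^L}` near the identity to the Lie algebra of `Sp(n)` and to the part
`V` of it fixed by `X ↦ X^L`; both sets are orbits of `Sp(n)`, under `X ↦ A X` and `X ↦ A X A^L`, so
they are submanifolds everywhere. A Lagrangian subspace `L` with orthogonal projection `P` is sent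
to `(2 P - 1) I_{n,n}`, which is `Q Q^L` for `L = Q (ℂⁿ × {0})`. Hence `LGr`, `Sp(n)/U(n)` and
`{Q Q^L}` are embedded in the space of matrices with the same image, and are diffeomorphic.
Finally, for `Z` in `V`,
`Q cayley(Z) (Q cayley(Z))^L = Q Q^L - 4 Q Z (1 + Z)⁻² Q^L`,
whose derivative at `Z = 0` is injective; since `V` has the dimension of `Sp(n)/U(n)`, the
projection is a submersion.
-/

section SliceCharts

variable {𝕜 V E F M : Type*} [NontriviallyNormedField 𝕜] [NormedAddCommGroup V] [NormedSpace 𝕜 V]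
  [NormedAddCommGroup E] [NormedSpace 𝕜 E] [NormedAddCommGroup F] [NormedSpace 𝕜 F]
  {k : WithTop ℕ∞}

/-- A chart of class `C^k` of the ambient space `V` which straightens the subset `S` to the first
factor of the splitting `g : E × F ≃ V`; a set covered by such charts is a submanifold of `V`
modelled on `E`. -/
structure SliceChart (k : WithTop ℕ∞) (g : (E × F) ≃L[𝕜] V) (S : Set V) where
  /-- The underlying chart of `V`. -/
  chart : OpenPartialHomeomorph V V
  contDiffOn_chart : ContDiffOn 𝕜 k chart chart.source
  contDiffOn_symm : ContDiffOn 𝕜 k chart.symm chart.target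
  mem_iff : ∀ y ∈ chart.source, y ∈ S ↔ (g.symm (chart y)).2 = 0

namespace SliceChart

variable {g : (E × F) ≃L[𝕜] V} {j : M → V}

theorem apply_mk_fst (c : SliceChart k g (Set.range j)) {m : M} (hm : j m ∈ c.chart.source) :
    g ((g.symm (c.chart (j m))).1, 0) = c.chart (j m) := by
  rw [← (c.mem_iff _ hm).1 (Set.mem_range_self m), Prod.mk.eta, g.apply_symm_apply]

variable [Nonempty M]

theorem apply_invFun (c : SliceChart k g (Set.range j)) {z : E} (hz : g (z, 0) ∈ c.chart.target) :
    j (Function.invFun j (c.chart.symm (g (z, 0)))) = c.chart.symm (g (z, 0)) := by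
  refine Function.invFun_eq ((c.mem_iff _ (c.chart.map_target hz)).2 ?_)
  rw [c.chart.right_inv hz, g.symm_apply_apply]

variable [TopologicalSpace M]

/-- The chart of an embedded space induced by a slice chart of the ambient space. -/
noncomputable def restrict (c : SliceChart k g (Set.range j)) (hj : Topology.IsEmbedding j) :
    OpenPartialHomeomorph M E where
  toFun m := (g.symm (c.chart (j m))).1
  invFun z := Function.invFun j (c.chart.symm (g (z, 0)))
  source := j ⁻¹' c.chart.source
  target := {z | g (z, 0) ∈ c.chart.target}
  map_source' m hm := by
    rw [Set.mem_ofPred_eq, c.apply_mk_fst hm]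
    exact c.chart.map_source hm
  map_target' z hz := by
    rw [Set.mem_preimage, c.apply_invFun hz]
    exact c.chart.map_target hz
  left_inv' m hm := by
    rw [c.apply_mk_fst hm, c.chart.left_inv hm]
    exact Function.leftInverse_invFun hj.injective m
  right_inv' z hz := by rw [c.apply_invFun hz, c.chart.right_inv hz, g.symm_apply_apply]
  open_source := c.chart.open_source.preimage hj.continuous
  open_target := c.chart.open_target.preimage (by fun_prop)
  continuousOn_toFun := (continuous_fst.comp g.symm.continuous).comp_continuousOn
    (c.chart.continuousOn.comp hj.continuous.continuousOn fun _ hm => hm)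
  continuousOn_invFun := by
    rw [hj.continuousOn_iff]
    have hg : Continuous fun z : E => g (z, 0) := by fun_prop
    exact (c.chart.continuousOn_symm.comp hg.continuousOn fun _ hz => hz).congr
      fun z hz => c.apply_invFun hz

theorem apply_restrict_symm (c : SliceChart k g (Set.range j)) (hj : Topology.IsEmbedding j)
    {z : E} (hz : z ∈ (c.restrict hj).target) :
    j ((c.restrict hj).symm z) = c.chart.symm (g (z, 0)) :=
  c.apply_invFun hz

theorem contDiffOn_transition (c d : SliceChart k g (Set.range j))
    (hj : Topology.IsEmbedding j) :
    ContDiffOn 𝕜 k ((c.restrict hj).symm.trans (d.restrict hj))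
      ((c.restrict hj).symm.trans (d.restrict hj)).source := by
  have hg : ContDiff 𝕜 k fun z : E => g (z, 0) :=
    g.contDiff.comp (contDiff_id.prodMk contDiff_const)
  have hs : ContDiffOn 𝕜 k (fun z : E => (g.symm (d.chart (c.chart.symm (g (z, 0))))).1)
      ((c.restrict hj).symm.trans (d.restrict hj)).source := by
    refine (contDiff_fst.comp g.symm.contDiff).comp_contDiffOn (d.contDiffOn_chart.comp
      (c.contDiffOn_symm.comp hg.contDiffOn fun z hz => hz.1) fun z hz => ?_)
    have hd : j ((c.restrict hj).symm z) ∈ d.chart.source := hz.2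
    rwa [c.apply_restrict_symm hj hz.1] at hd
  refine hs.congr fun z hz => ?_
  change (g.symm (d.chart (j ((c.restrict hj).symm z)))).1 = _
  rw [c.apply_restrict_symm hj hz.1]

theorem isImmersionAtOfComplement [ChartedSpace E M] [IsManifold 𝓘(𝕜, E) k M]
    (c : SliceChart k g (Set.range j)) (hj : Topology.IsEmbedding j) {m : M}
    (hm : j m ∈ c.chart.source)
    (hc : c.restrict hj ∈ IsManifold.maximalAtlas 𝓘(𝕜, E) k M) :
    Manifold.IsImmersionAtOfComplement F 𝓘(𝕜, E) 𝓘(𝕜, V) k j m := by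
  refine Manifold.IsImmersionAtOfComplement.mk_of_charts g (c.restrict hj) c.chart hm hm hc
    ?_ (fun _ h => h) fun z hz => ?_
  · exact OpenPartialHomeomorph.mem_maximalAtlas_of_contMDiffOn _
      c.contDiffOn_chart.contMDiffOn c.contDiffOn_symm.contMDiffOn
  · have hz' : z ∈ (c.restrict hj).target := by simpa using hz
    change c.chart (j ((c.restrict hj).symm z)) = g (z, 0)
    rw [c.apply_restrict_symm hj hz', c.chart.right_inv hz']

end SliceChart

theorem exists_isSmoothEmbedding_of_sliceCharts [TopologicalSpace M] {g : (E × F) ≃L[𝕜] V}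
    {j : M → V} (hj : Topology.IsEmbedding j)
    (h : ∀ m, ∃ c : SliceChart k g (Set.range j), j m ∈ c.chart.source) :
    ∃ _ : ChartedSpace E M,
      IsManifold 𝓘(𝕜, E) k M ∧ Manifold.IsSmoothEmbedding 𝓘(𝕜, E) 𝓘(𝕜, V) k j := by
  choose c hc using h
  let φ : M → OpenPartialHomeomorph M E := fun m =>
    haveI : Nonempty M := ⟨m⟩
    (c m).restrict hj
  let _ : ChartedSpace E M :=
    { atlas := Set.range φ
      chartAt := φ
      mem_chart_source := hc
      chart_mem_atlas := Set.mem_range_self }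
  have hM : IsManifold 𝓘(𝕜, E) k M := by
    refine isManifold_of_contDiffOn _ _ _ ?_
    rintro _ _ ⟨m, rfl⟩ ⟨m', rfl⟩
    have : Nonempty M := ⟨m⟩
    exact ((c m).contDiffOn_transition (c m') hj).mono fun z hz => hz.1
  refine ⟨inferInstance, hM, ⟨?_, hj⟩⟩
  refine Manifold.IsImmersionOfComplement.isImmersion (F := F) fun m => ?_
  have : Nonempty M := ⟨m⟩
  exact (c m).isImmersionAtOfComplement hj (hc m)
    (IsManifold.chart_mem_maximalAtlas (I := 𝓘(𝕜, E)) m)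

theorem exists_splitting_of_finrank_eq [CompleteSpace 𝕜] [FiniteDimensional 𝕜 V]
    [FiniteDimensional 𝕜 E] (W : Submodule 𝕜 V)
    (hW : Module.finrank 𝕜 W = Module.finrank 𝕜 E) :
    ∃ (F : Submodule 𝕜 V) (g : (E × F) ≃L[𝕜] V), ∀ v, v ∈ W ↔ (g.symm v).2 = 0 := by
  obtain ⟨F, hF⟩ := W.exists_isCompl
  let e : E ≃L[𝕜] W := ContinuousLinearEquiv.ofFinrankEq hW.symm
  let p : (W × F) ≃L[𝕜] V := (W.prodEquivOfIsCompl F hF).toContinuousLinearEquiv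
  refine ⟨F, (e.prodCongr (.refl 𝕜 F)).trans p, fun v => ?_⟩
  exact (Submodule.prodEquivOfIsCompl_symm_apply_snd_eq_zero W F hF).symm

end SliceCharts

section EmbeddedSubmanifolds

variable {𝕜 V E E' F H H' G M N : Type*} [NontriviallyNormedField 𝕜]
  [NormedAddCommGroup V] [NormedSpace 𝕜 V] [NormedAddCommGroup E] [NormedSpace 𝕜 E]
  [NormedAddCommGroup E'] [NormedSpace 𝕜 E'] [NormedAddCommGroup F] [NormedSpace 𝕜 F]
  [TopologicalSpace H] [TopologicalSpace H'] [TopologicalSpace G]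
  {I : ModelWithCorners 𝕜 E H} {I' : ModelWithCorners 𝕜 E' H'} {J : ModelWithCorners 𝕜 F G}
  {P : Type*} [TopologicalSpace P] [ChartedSpace G P]
  [TopologicalSpace M] [ChartedSpace H M] [TopologicalSpace N] [ChartedSpace H' N]
  {k : WithTop ℕ∞}

theorem contMDiff_of_comp_isSmoothEmbedding {f : M → N} {j : N → P}
    (hj : Manifold.IsSmoothEmbedding I' J k j) (h : ContMDiff I J k (j ∘ f)) :
    ContMDiff I I' k f :=
  (ContMDiff.iff_comp_isImmersion hj.isImmersion).2
    ⟨hj.isEmbedding.continuous_iff.2 h.continuous, h⟩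

theorem exists_diffeomorph_of_range_eq {i : M → P} {j : N → P}
    (hi : Manifold.IsSmoothEmbedding I J k i) (hj : Manifold.IsSmoothEmbedding I' J k j)
    (h : Set.range i = Set.range j) : ∃ Φ : M ≃ₘ^k⟮I, I'⟯ N, ∀ m, j (Φ m) = i m := by
  let Φ : M ≃ N := (Equiv.ofInjective i hi.isEmbedding.injective).trans
    ((Equiv.setCongr h).trans (Equiv.ofInjective j hj.isEmbedding.injective).symm)
  have hΦ : j ∘ Φ = i := funext fun m => Equiv.apply_ofInjective_symm hj.isEmbedding.injective _
  have hΦ' : i ∘ Φ.symm = j := by rw [← hΦ, Function.comp_assoc, Φ.self_comp_symm, Function.comp_id]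
  exact ⟨⟨Φ, contMDiff_of_comp_isSmoothEmbedding hj (hΦ ▸ hi.contMDiff),
    contMDiff_of_comp_isSmoothEmbedding hi (hΦ' ▸ hj.contMDiff)⟩, congrFun hΦ⟩

/-- If a family `s` through `s x` is mapped by `f` to one which is immersed at `x` in the
coordinates `κ`, and has as many parameters as `N` has dimensions, then `f` is a submersion at
`s x`. -/
theorem mfderiv_surjective_of_injective_fderiv_comp {X Y : Type*} [NormedAddCommGroup X]
    [NormedSpace 𝕜 X] [NormedAddCommGroup Y] [NormedSpace 𝕜 Y]
    [FiniteDimensional 𝕜 X] [FiniteDimensional 𝕜 E']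
    {f : M → N} {s : X → M} {κ : N → Y} {x : X}
    (hκ : MDifferentiableAt I' 𝓘(𝕜, Y) κ (f (s x))) (hf : MDifferentiableAt I I' f (s x))
    (hs : MDifferentiableAt 𝓘(𝕜, X) I s x)
    (hd : Function.Injective (fderiv 𝕜 (κ ∘ f ∘ s) x))
    (hdim : Module.finrank 𝕜 X = Module.finrank 𝕜 E') :
    Function.Surjective (mfderiv I I' f (s x)) := by
  have hdκ : mfderiv 𝓘(𝕜, X) 𝓘(𝕜, Y) (κ ∘ f ∘ s) x =
      (mfderiv I' 𝓘(𝕜, Y) κ (f (s x))).comp (mfderiv 𝓘(𝕜, X) I' (f ∘ s) x) :=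
    mfderiv_comp x hκ (hf.comp x hs)
  have hdf : mfderiv 𝓘(𝕜, X) I' (f ∘ s) x =
      (mfderiv I I' f (s x)).comp (mfderiv 𝓘(𝕜, X) I s x) := mfderiv_comp x hf hs
  let D : X →ₗ[𝕜] E' := (mfderiv 𝓘(𝕜, X) I' (f ∘ s) x).toLinearMap
  have hD : Function.Injective D := by
    rw [← mfderiv_eq_fderiv, hdκ] at hd
    exact Function.Injective.of_comp hd
  have hD' : Function.Surjective D :=
    (LinearMap.injective_iff_surjective_of_finrank_eq_finrank hdim).1 hD
  intro w
  obtain ⟨z, hz⟩ := hD' w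
  exact ⟨mfderiv 𝓘(𝕜, X) I s x z, by rw [← hz]; exact (DFunLike.congr_fun hdf z).symm⟩

end EmbeddedSubmanifolds

section EntrywiseContDiffAt

variable {𝕜 X R l m p : Type*} [NontriviallyNormedField 𝕜] [NormedAddCommGroup X]
  [NormedSpace 𝕜 X] {k : WithTop ℕ∞} {x : X}

/-- All entries of the matrix-valued function `f` are of class `C^k` at `x`. Matrices carry no
global norm, so that differentiability of matrix expressions is proved in this form. -/
def EntrywiseContDiffAt (𝕜 : Type*) {X R l m : Type*} [NontriviallyNormedField 𝕜]
    [NormedAddCommGroup X] [NormedSpace 𝕜 X] [NormedAddCommGroup R] [NormedSpace 𝕜 R]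
    (k : WithTop ℕ∞) (f : X → Matrix l m R) (x : X) : Prop :=
  ∀ i j, ContDiffAt 𝕜 k (fun y => f y i j) x

namespace EntrywiseContDiffAt

section NormedSpace

variable [NormedAddCommGroup R] [NormedSpace 𝕜 R] {f g : X → Matrix l m R}

theorem const (A : Matrix l m R) : EntrywiseContDiffAt 𝕜 k (fun _ : X => A) x :=
  fun _ _ => contDiffAt_const

theorem add (hf : EntrywiseContDiffAt 𝕜 k f x) (hg : EntrywiseContDiffAt 𝕜 k g x) :
    EntrywiseContDiffAt 𝕜 k (fun y => f y + g y) x :=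
  fun i j => (hf i j).add (hg i j)

theorem sub (hf : EntrywiseContDiffAt 𝕜 k f x) (hg : EntrywiseContDiffAt 𝕜 k g x) :
    EntrywiseContDiffAt 𝕜 k (fun y => f y - g y) x :=
  fun i j => (hf i j).sub (hg i j)

theorem const_smul {S : Type*} [Monoid S] [DistribMulAction S R] [ContinuousConstSMul S R]
    [SMulCommClass 𝕜 S R] (c : S) (hf : EntrywiseContDiffAt 𝕜 k f x) :
    EntrywiseContDiffAt 𝕜 k (fun y => c • f y) x :=
  fun i j => (hf i j).const_smul c

theorem conjTranspose [StarRing 𝕜] [TrivialStar 𝕜] [StarAddMonoid R] [ContinuousStar R]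
    [StarModule 𝕜 R] (hf : EntrywiseContDiffAt 𝕜 k f x) :
    EntrywiseContDiffAt 𝕜 k (fun y => (f y)ᴴ) x :=
  fun i j => (starL' 𝕜 : R ≃L[𝕜] R).contDiff.contDiffAt.comp x (hf j i)

variable [Fintype l] [Fintype m]

theorem contDiffAt (hf : EntrywiseContDiffAt 𝕜 k f x) :
    ContDiffAt 𝕜 k (fun y => Matrix.of.symm (f y)) x :=
  contDiffAt_pi.2 fun i => contDiffAt_pi.2 fun j => hf i j

theorem of_contDiffAt {f : X → l → m → R} (hf : ContDiffAt 𝕜 k f x) :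
    EntrywiseContDiffAt 𝕜 k (fun y => Matrix.of (f y)) x :=
  fun i j => contDiffAt_pi.1 (contDiffAt_pi.1 hf i) j

theorem of_id {x : l → m → R} :
    EntrywiseContDiffAt 𝕜 k (fun y : l → m → R => Matrix.of y) x :=
  of_contDiffAt contDiffAt_id

end NormedSpace

theorem mul [NormedRing R] [NormedAlgebra 𝕜 R] [Fintype m] {f : X → Matrix l m R}
    {g : X → Matrix m p R} (hf : EntrywiseContDiffAt 𝕜 k f x)
    (hg : EntrywiseContDiffAt 𝕜 k g x) : EntrywiseContDiffAt 𝕜 k (fun y => f y * g y) x :=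
  fun i j => by
    simp only [Matrix.mul_apply]
    exact ContDiffAt.sum fun a _ => (hf i a).mul (hg a j)

variable [Fintype m] [DecidableEq m] {f : X → Matrix m m R}

theorem det [NormedCommRing R] [NormedAlgebra 𝕜 R] (hf : EntrywiseContDiffAt 𝕜 k f x) :
    ContDiffAt 𝕜 k (fun y => (f y).det) x := by
  simp only [Matrix.det_apply']
  exact ContDiffAt.sum fun σ _ => contDiffAt_const.mul (contDiffAt_prod fun i _ => hf _ _)

theorem inv [NormedField R] [NormedAlgebra 𝕜 R] (hf : EntrywiseContDiffAt 𝕜 k f x)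
    (h : IsUnit (f x)) : EntrywiseContDiffAt 𝕜 k (fun y => (f y)⁻¹) x := fun i j => by
  have hdet : (f x).det ≠ 0 := ((f x).isUnit_iff_isUnit_det.1 h).ne_zero
  simp only [Matrix.inv_def, Ring.inverse_eq_inv', Matrix.smul_apply, Matrix.adjugate_apply,
    smul_eq_mul]
  refine (hf.det.inv hdet).mul (det fun a b => ?_)
  rcases eq_or_ne a j with rfl | ha
  · simp only [Matrix.updateRow_self]
    exact contDiffAt_const
  · simp only [Matrix.updateRow_ne ha]
    exact hf a b

end EntrywiseContDiffAt

end EntrywiseContDiffAt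

section Cayley

open scoped Ring

variable {R S : Type*} [Ring R] [Ring S]

/-- The Cayley transform `x ↦ (1 - x) (1 + x)⁻¹` of a ring, meaningful where `1 + x` is
invertible. -/
noncomputable def cayley (x : R) : R := (1 - x) * (1 + x)⁻¹ʳ

theorem cayley_zero : cayley (0 : R) = 1 := by simp [cayley]

variable {x y : R}

theorem cayley_mul_one_add (h : IsUnit (1 + x)) : cayley x * (1 + x) = 1 - x := by
  rw [cayley, mul_assoc, Ring.inverse_mul_cancel _ h, mul_one]

theorem one_add_mul_cayley (h : IsUnit (1 + x)) : (1 + x) * cayley x = 1 - x := by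
  have hcomm : (1 + x) * (1 - x) = (1 - x) * (1 + x) := by noncomm_ring
  rw [cayley, ← mul_assoc, hcomm, mul_assoc, Ring.mul_inverse_cancel _ h, mul_one]

theorem eq_cayley_iff (h : IsUnit (1 + x)) : y = cayley x ↔ y * (1 + x) = 1 - x := by
  rw [← cayley_mul_one_add h, h.mul_left_inj]

theorem isUnit_one_add_cayley (h2 : IsUnit (2 : R)) (h : IsUnit (1 + x)) :
    IsUnit (1 + cayley x) := by
  have hmul : (1 + cayley x) * (1 + x) = 2 := by
    rw [add_mul, cayley_mul_one_add h, one_mul, add_add_sub_cancel, one_add_one_eq_two]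
  rw [← h.mul_right_iff, hmul]
  exact h2

theorem cayley_cayley (h2 : IsUnit (2 : R)) (h : IsUnit (1 + x)) : cayley (cayley x) = x := by
  symm
  rw [eq_cayley_iff (isUnit_one_add_cayley h2 h)]
  have hx := one_add_mul_cayley h
  rw [add_mul, one_mul] at hx
  rw [mul_add, mul_one, eq_sub_of_add_eq' hx]
  abel

theorem isUnit_one_add_unop_map (f : R →+* Sᵐᵒᵖ) (h : IsUnit (1 + x)) :
    IsUnit (1 + (f x).unop) := by
  simpa using (h.map f).unop

theorem unop_map_cayley (f : R →+* Sᵐᵒᵖ) (h : IsUnit (1 + x)) :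
    (f (cayley x)).unop = cayley (f x).unop := by
  rw [eq_cayley_iff (isUnit_one_add_unop_map f h)]
  simpa using congrArg (MulOpposite.unop ∘ f) (one_add_mul_cayley h)

/-- The Cayley transform turns the equation `y k x = k` of a group preserving the form `k` into
that of its Lie algebra. -/
theorem mul_mul_eq_iff_cayley (h2 : IsUnit (2 : R)) (hx : IsUnit (1 + x)) (hy : IsUnit (1 + y))
    (k : R) : y * k * x = k ↔ cayley y * k = -(k * cayley x) := by
  have key : (1 + y) * (cayley y * k + k * cayley x) * (1 + x) = 2 * (k - y * k * x) := by
    calc _ = ((1 + y) * cayley y) * k * (1 + x) + (1 + y) * k * (cayley x * (1 + x)) := by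
          noncomm_ring
      _ = _ := by
          rw [one_add_mul_cayley hy, cayley_mul_one_add hx]
          noncomm_ring
  rw [eq_neg_iff_add_eq_zero, ← hy.mul_right_eq_zero, ← hx.mul_left_eq_zero, key,
    h2.mul_right_eq_zero, sub_eq_zero, eq_comm]

theorem cayley_mul_cayley (h : IsUnit (1 + x)) :
    cayley x * cayley x = 1 - 4 * (x * ((1 + x)⁻¹ʳ * (1 + x)⁻¹ʳ)) := by
  have hcancel := Ring.inverse_mul_cancel _ h
  have hcomm : (1 - x) * (1 + x) = (1 + x) * (1 - x) := by noncomm_ring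
  rw [← h.mul_left_inj, ← h.mul_left_inj]
  calc cayley x * cayley x * (1 + x) * (1 + x)
      = (1 - x) * (1 - x) := by
        rw [mul_assoc (cayley x), cayley_mul_one_add h, mul_assoc, hcomm, ← mul_assoc,
          cayley_mul_one_add h]
    _ = (1 + x) * (1 + x) - 4 * x := by noncomm_ring
    _ = _ := by
        rw [sub_mul, sub_mul, one_mul]
        simp only [mul_assoc, hcancel, mul_one]

end Cayley

section MatrixCayley

variable {𝕜 𝕂 X m : Type*} [NontriviallyNormedField 𝕜] [NontriviallyNormedField 𝕂]
  [Fintype m] [DecidableEq m] {k : WithTop ℕ∞}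

theorem EntrywiseContDiffAt.cayley [NormedAlgebra 𝕜 𝕂] [NormedAddCommGroup X] [NormedSpace 𝕜 X]
    {x : X} {f : X → Matrix m m 𝕂} (hf : EntrywiseContDiffAt 𝕜 k f x) (h : IsUnit (1 + f x)) :
    EntrywiseContDiffAt 𝕜 k (fun y => cayley (f y)) x := by
  simp only [_root_.cayley, ← Matrix.nonsing_inv_eq_ringInverse]
  exact ((const 1).sub hf).mul (((const 1).add hf).inv h)

theorem isOpen_setOf_isUnit_matrix [TopologicalSpace X] {f : X → Matrix m m 𝕂}
    (hf : Continuous f) : IsOpen {x | IsUnit (f x)} := by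
  simp only [Matrix.isUnit_iff_isUnit_det, isUnit_iff_ne_zero]
  exact isOpen_ne_fun hf.matrix_det continuous_const

theorem isUnit_two_matrix [CharZero 𝕂] : IsUnit (2 : Matrix m m 𝕂) := by
  have h := (IsUnit.mk0 (2 : 𝕂) two_ne_zero).map (algebraMap 𝕂 (Matrix m m 𝕂))
  rwa [map_ofNat] at h

variable (P Q : (Matrix m m 𝕂)ˣ)

theorem EntrywiseContDiffAt.cayley_conj [NormedAlgebra 𝕜 𝕂] {X : m → m → 𝕂}
    (hX : IsUnit (1 + P⁻¹.1 * Matrix.of X * Q⁻¹.1)) :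
    EntrywiseContDiffAt 𝕜 k (fun X => _root_.cayley (P⁻¹.1 * Matrix.of X * Q⁻¹.1)) X :=
  (((const _).mul of_id).mul (const _)).cayley hX

theorem EntrywiseContDiffAt.conj_cayley [NormedAlgebra 𝕜 𝕂] {Y : m → m → 𝕂}
    (hY : IsUnit (1 + Matrix.of Y)) :
    EntrywiseContDiffAt 𝕜 k (fun Y => P.1 * _root_.cayley (Matrix.of Y) * Q.1) Y :=
  ((const _).mul (of_id.cayley hY)).mul (const _)

/-- The chart `X ↦ cayley (P⁻¹ X Q⁻¹)` of the space of matrices, which sends `P Q` to zero. -/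
noncomputable def cayleyChart [CharZero 𝕂] :
    OpenPartialHomeomorph (m → m → 𝕂) (m → m → 𝕂) where
  toFun X := Matrix.of.symm (cayley (P⁻¹.1 * Matrix.of X * Q⁻¹.1))
  invFun Y := Matrix.of.symm (P * cayley (Matrix.of Y) * Q)
  source := {X | IsUnit (1 + P⁻¹.1 * Matrix.of X * Q⁻¹.1)}
  target := {Y | IsUnit (1 + Matrix.of Y)}
  map_source' _ hX := isUnit_one_add_cayley isUnit_two_matrix hX
  map_target' _ hY := by simpa [mul_assoc] using isUnit_one_add_cayley isUnit_two_matrix hY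
  left_inv' _ hX := by
    simp only [Equiv.apply_symm_apply]
    rw [cayley_cayley isUnit_two_matrix hX]
    simp [mul_assoc]
  right_inv' _ hY := by
    have h := cayley_cayley isUnit_two_matrix hY
    simp only [Equiv.apply_symm_apply]
    simp [mul_assoc, h]
  open_source := isOpen_setOf_isUnit_matrix (continuous_const.add
    ((continuous_const.matrix_mul continuous_id).matrix_mul continuous_const))
  open_target := isOpen_setOf_isUnit_matrix (continuous_const.add continuous_id)
  continuousOn_toFun _ hX := (EntrywiseContDiffAt.cayley_conj (𝕜 := 𝕂) (k := 0) P Q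
    hX).contDiffAt.continuousAt.continuousWithinAt
  continuousOn_invFun _ hY := (EntrywiseContDiffAt.conj_cayley (𝕜 := 𝕂) (k := 0) P Q
    hY).contDiffAt.continuousAt.continuousWithinAt

variable [CharZero 𝕂] [NormedAlgebra 𝕜 𝕂]

theorem contDiffOn_cayleyChart :
    ContDiffOn 𝕜 k (cayleyChart P Q) (cayleyChart P Q).source := fun _ hX =>
  (EntrywiseContDiffAt.cayley_conj P Q hX).contDiffAt.contDiffWithinAt

theorem contDiffOn_cayleyChart_symm :
    ContDiffOn 𝕜 k (cayleyChart P Q).symm (cayleyChart P Q).target := fun _ hY =>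
  (EntrywiseContDiffAt.conj_cayley P Q hY).contDiffAt.contDiffWithinAt

end MatrixCayley

section SkewAdjoint

variable {A : Type*} [AddCommGroup A] [Module ℂ A] [StarAddMonoid A] [StarModule ℂ A]

theorem negISMul_bijective : Function.Bijective (skewAdjoint.negISMul (A := A)) := by
  refine ⟨fun a b h => Subtype.ext ?_, fun a => ?_⟩
  · simpa using congrArg (fun c : selfAdjoint A => Complex.I • (c : A)) h
  · refine ⟨⟨Complex.I • (a : A), ?_⟩, Subtype.ext ?_⟩
    · rw [skewAdjoint.mem_iff, star_smul, a.2.star_eq, Complex.star_def, Complex.conj_I, neg_smul]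
    · simp [smul_smul]

theorem finiteDimensional_skewAdjoint [FiniteDimensional ℂ A] :
    FiniteDimensional ℝ (skewAdjoint A) :=
  have : FiniteDimensional ℝ A := FiniteDimensional.complexToReal A
  inferInstanceAs (FiniteDimensional ℝ (skewAdjoint.submodule ℝ A))

theorem finrank_skewAdjoint [FiniteDimensional ℂ A] :
    Module.finrank ℝ (skewAdjoint A) = Module.finrank ℂ A := by
  have : FiniteDimensional ℝ (skewAdjoint A) := finiteDimensional_skewAdjoint
  let e := LinearEquiv.ofBijective _ (negISMul_bijective (A := A))
  have : FiniteDimensional ℝ (selfAdjoint A) := e.finiteDimensional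
  have hsum := (StarModule.decomposeProdAdjoint ℝ A).finrank_eq
  have heq := e.finrank_eq
  rw [Module.finrank_prod, finrank_real_of_complex] at hsum
  omega

end SkewAdjoint

namespace ComplexLagrangian

variable {n : ℕ}

theorem mem_Sp_iff {Q : BlockMat n} :
    Q ∈ Sp n ↔ Qᴴ * 1 * Q = 1 ∧ Qᵀ * Matrix.J (Fin n) ℂ * Q = Matrix.J (Fin n) ℂ := by
  rw [mul_one, ← SymplecticGroup.mem_iff', ← Matrix.star_eq_conjTranspose,
    ← Matrix.mem_unitaryGroup_iff']
  rfl

theorem Inn_mul_Inn : Inn n * Inn n = 1 := by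
  simp [Inn, Matrix.fromBlocks_multiply]

theorem Inn_conjTranspose : (Inn n)ᴴ = Inn n := by
  simp [Inn, Matrix.fromBlocks_conjTranspose]

theorem Inn_transpose : (Inn n)ᵀ = Inn n := by
  simp [Inn, Matrix.fromBlocks_transpose]

theorem Inn_mul_J_mul_Inn : Inn n * Matrix.J (Fin n) ℂ * Inn n = -Matrix.J (Fin n) ℂ := by
  simp [Inn, Matrix.J, Matrix.fromBlocks_multiply, Matrix.fromBlocks_neg]

theorem Inn_mul_mul_Inn_mem_Sp {Q : BlockMat n} (hQ : Q ∈ Sp n) : Inn n * Q * Inn n ∈ Sp n := by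
  obtain ⟨hU, hJ⟩ := mem_Sp_iff.1 hQ
  rw [mem_Sp_iff]
  simp only [Matrix.conjTranspose_mul, Matrix.transpose_mul, Inn_conjTranspose, Inn_transpose]
  constructor
  · calc _ = Inn n * (Qᴴ * (Inn n * Inn n) * Q) * Inn n := by noncomm_ring
      _ = 1 := by rw [Inn_mul_Inn, hU, mul_one, Inn_mul_Inn]
  · calc _ = Inn n * (Qᵀ * (Inn n * Matrix.J (Fin n) ℂ * Inn n) * Q) * Inn n := by noncomm_ring
      _ = -(Inn n * (Qᵀ * Matrix.J (Fin n) ℂ * Q) * Inn n) := by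
          rw [Inn_mul_J_mul_Inn]; noncomm_ring
      _ = _ := by rw [hJ, Inn_mul_J_mul_Inn, neg_neg]

/-- The involution `Q ↦ I_{n,n} Q I_{n,n}` of `Sp(n)` whose fixed points form `U(n)`, so that
`Q Q^L = Q σ(Q)⁻¹` is the Cartan embedding of the symmetric space `Sp(n)/U(n)`. -/
def involution (n : ℕ) : Sp n →* Sp n where
  toFun Q := ⟨Inn n * Q.1 * Inn n, Inn_mul_mul_Inn_mem_Sp Q.2⟩
  map_one' := Subtype.ext (by simp [Inn_mul_Inn])
  map_mul' Q R := Subtype.ext <| by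
    calc Inn n * (Q.1 * R.1) * Inn n = Inn n * Q.1 * 1 * R.1 * Inn n := by noncomm_ring
      _ = _ := by rw [← Inn_mul_Inn]; simp only [Submonoid.coe_mul, mul_assoc]

theorem lagAdj_coe (Q : Sp n) : lagAdj Q.1 = ((involution n Q)⁻¹ : Sp n).1 := by
  change _ = (Inn n * Q.1 * Inn n)ᴴ
  simp only [lagAdj, Matrix.conjTranspose_mul, Inn_conjTranspose, mul_assoc]

theorem mul_lagAdj_coe (Q : Sp n) : Q.1 * lagAdj Q.1 = (Q * (involution n Q)⁻¹ : Sp n).1 := by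
  rw [lagAdj_coe]
  rfl

theorem lagAdj_lagAdj (X : BlockMat n) : lagAdj (lagAdj X) = X := by
  simp only [lagAdj, Matrix.conjTranspose_mul, Inn_conjTranspose,
    Matrix.conjTranspose_conjTranspose]
  calc _ = (Inn n * Inn n) * X * (Inn n * Inn n) := by noncomm_ring
    _ = _ := by rw [Inn_mul_Inn, one_mul, mul_one]

/-- The Lagrangian adjoint as an anti-endomorphism of the matrix ring. -/
def lagAdjHom (n : ℕ) : BlockMat n →+* (BlockMat n)ᵐᵒᵖ where
  toFun X := .op (lagAdj X)
  map_one' := by simp [lagAdj, Inn_mul_Inn]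
  map_zero' := by simp [lagAdj]
  map_add' X Y := by simp [lagAdj, mul_add, add_mul]
  map_mul' X Y := MulOpposite.unop_injective <| by
    calc Inn n * (X * Y)ᴴ * Inn n = Inn n * Yᴴ * 1 * Xᴴ * Inn n := by
          rw [Matrix.conjTranspose_mul, mul_one, ← mul_assoc]
      _ = _ := by
          rw [← Inn_mul_Inn]
          simp only [MulOpposite.unop_mul, MulOpposite.unop_op, lagAdj, mul_assoc]

theorem lagAdj_mul (X Y : BlockMat n) : lagAdj (X * Y) = lagAdj Y * lagAdj X :=
  congrArg MulOpposite.unop (map_mul (lagAdjHom n) X Y)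

theorem lagAdj_cayley {Z : BlockMat n} (h : IsUnit (1 + Z)) :
    lagAdj (cayley Z) = cayley (lagAdj Z) :=
  unop_map_cayley (lagAdjHom n) h

theorem isUnit_one_add_lagAdj {Z : BlockMat n} (h : IsUnit (1 + Z)) : IsUnit (1 + lagAdj Z) :=
  isUnit_one_add_unop_map (lagAdjHom n) h

/-- The Lie algebra of `Sp(n)`, as a space of arrays of entries. -/
noncomputable def spLie (n : ℕ) : Submodule ℝ (Entries n) :=
  (skewAdjoint.submodule ℝ (BlockMat n) ⊓
    (skewAdjointMatricesSubmodule (Matrix.J (Fin n) ℂ)).restrictScalars ℝ).comap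
      (Matrix.ofLinearEquiv ℝ).toLinearMap

/-- The part of the Lie algebra of `Sp(n)` fixed by the Lagrangian adjoint: the tangent space of
`Sp(n)/U(n)` at the base point. -/
noncomputable def symLie (n : ℕ) : Submodule ℝ (Entries n) :=
  spLie n ⊓ (V2 n).comap (Matrix.ofLinearEquiv ℝ).toLinearMap

theorem entries_mem_spLie_iff {Z : BlockMat n} : entries Z ∈ spLie n ↔
    Zᴴ = -Z ∧ Zᵀ * Matrix.J (Fin n) ℂ = -(Matrix.J (Fin n) ℂ * Z) := by
  rw [← mul_neg]
  exact and_congr_right' (mem_skewAdjointMatricesSubmodule _ _)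

theorem entries_fromBlocks_mem_spLie_iff {A B C D : Matrix (Fin n) (Fin n) ℂ} :
    entries (Matrix.fromBlocks A B C D) ∈ spLie n ↔
      Aᴴ = -A ∧ Cᵀ = C ∧ B = -Cᴴ ∧ D = -Aᵀ := by
  rw [entries_mem_spLie_iff, Matrix.J]
  simp only [Matrix.fromBlocks_conjTranspose, Matrix.fromBlocks_transpose,
    Matrix.fromBlocks_multiply, Matrix.fromBlocks_neg, Matrix.fromBlocks_inj, mul_zero, zero_mul,
    mul_one, one_mul, mul_neg, neg_mul, zero_add, add_zero, neg_neg]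
  constructor
  · rintro ⟨⟨hA, hC, -, -⟩, hCC, hD, -, -⟩
    exact ⟨hA, hCC, by rw [hC, neg_neg], by rw [hD]⟩
  · rintro ⟨hA, hC, rfl, rfl⟩
    have hC' : Cᴴᵀ = Cᴴ := congrArg Matrix.conjTranspose hC
    have hA' : Aᵀᴴ = -Aᵀ := congrArg Matrix.transpose hA
    simp [hA, hA', hC, hC']

theorem entries_mem_spLie_iff_toBlocks {Z : BlockMat n} : entries Z ∈ spLie n ↔
    Z.toBlocks₁₁ᴴ = -Z.toBlocks₁₁ ∧ Z.toBlocks₂₁ᵀ = Z.toBlocks₂₁ ∧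
      Z.toBlocks₁₂ = -Z.toBlocks₂₁ᴴ ∧ Z.toBlocks₂₂ = -Z.toBlocks₁₁ᵀ := by
  rw [← entries_fromBlocks_mem_spLie_iff, Matrix.fromBlocks_toBlocks]

theorem entries_fromBlocks_mem_symLie_iff {A B C D : Matrix (Fin n) (Fin n) ℂ} :
    entries (Matrix.fromBlocks A B C D) ∈ symLie n ↔ A = 0 ∧ Cᵀ = C ∧ B = -Cᴴ ∧ D = 0 := by
  have hV : Matrix.fromBlocks A B C D ∈ V2 n ↔ A = Aᴴ ∧ B = -Cᴴ ∧ C = -Bᴴ ∧ D = Dᴴ := by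
    change Matrix.fromBlocks A B C D = Inn n * (Matrix.fromBlocks A B C D)ᴴ * Inn n ↔ _
    simp [Inn, Matrix.fromBlocks_conjTranspose, Matrix.fromBlocks_multiply, Matrix.fromBlocks_inj]
  change _ ∈ spLie n ∧ Matrix.fromBlocks A B C D ∈ V2 n ↔ _
  rw [entries_fromBlocks_mem_spLie_iff, hV]
  constructor
  · rintro ⟨⟨hA, hC, hB, hD⟩, hA', -, -, -⟩
    have hA0 : A = 0 := Matrix.ext fun i j => self_eq_neg.1 (congrFun₂ (hA'.trans hA) i j)
    exact ⟨hA0, hC, hB, by rw [hD, hA0, Matrix.transpose_zero, neg_zero]⟩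
  · rintro ⟨rfl, hC, rfl, rfl⟩
    simp [hC]

theorem cayley_mem_spLie_iff {Z : BlockMat n} (h : IsUnit (1 + Z)) :
    entries (cayley Z) ∈ spLie n ↔ Z ∈ Sp n := by
  let conjT : BlockMat n →+* (BlockMat n)ᵐᵒᵖ := (starRingEquiv (R := BlockMat n)).toRingHom
  let transp : BlockMat n →+* (BlockMat n)ᵐᵒᵖ := (Matrix.transposeRingEquiv _ ℂ).toRingHom
  have hH : IsUnit (1 + Zᴴ) := isUnit_one_add_unop_map conjT h
  have hT : IsUnit (1 + Zᵀ) := isUnit_one_add_unop_map transp h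
  have hcH : (cayley Z)ᴴ = cayley Zᴴ := unop_map_cayley conjT h
  have hcT : (cayley Z)ᵀ = cayley Zᵀ := unop_map_cayley transp h
  rw [mem_Sp_iff, entries_mem_spLie_iff, mul_mul_eq_iff_cayley isUnit_two_matrix h hH,
    mul_mul_eq_iff_cayley isUnit_two_matrix h hT, mul_one, one_mul, hcH, hcT]

theorem cayley_mem_symLie_iff {Z : BlockMat n} (h : IsUnit (1 + Z)) :
    entries (cayley Z) ∈ symLie n ↔ Z ∈ Sp n ∧ Z = lagAdj Z := by
  refine and_congr (cayley_mem_spLie_iff h) ?_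
  change cayley Z = lagAdj (cayley Z) ↔ _
  rw [lagAdj_cayley h]
  refine ⟨fun e => ?_, fun e => by rw [← e]⟩
  exact (cayley_cayley isUnit_two_matrix h).symm.trans ((congrArg cayley e).trans
    (cayley_cayley isUnit_two_matrix (isUnit_one_add_lagAdj h)))

/-- The parametrization of the Lie algebra of `Sp(n)` by its first block column. -/
noncomputable def spLieEquiv (n : ℕ) :
    (skewAdjoint (Matrix (Fin n) (Fin n) ℂ) × Sym n) ≃ₗ[ℝ] spLie n where
  toFun p := ⟨entries (Matrix.fromBlocks p.1 (-(Sym.toMatrix p.2)ᴴ) (Sym.toMatrix p.2) (-p.1.1ᵀ)),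
    entries_fromBlocks_mem_spLie_iff.2 ⟨p.1.2, Matrix.ext fun i j => p.2.2 j i, rfl, rfl⟩⟩
  invFun Y :=
    have hY := (entries_mem_spLie_iff_toBlocks (Z := Matrix.of Y.1)).1 Y.2
    (⟨(Matrix.of Y.1).toBlocks₁₁, hY.1⟩,
      ⟨Matrix.of.symm (Matrix.of Y.1).toBlocks₂₁, fun i j => congrFun₂ hY.2.1 j i⟩)
  map_add' p q := Subtype.ext <| Matrix.of.injective <| by
    change Matrix.fromBlocks (p.1.1 + q.1.1) (-(Sym.toMatrix p.2 + Sym.toMatrix q.2)ᴴ)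
      (Sym.toMatrix p.2 + Sym.toMatrix q.2) (-(p.1.1 + q.1.1)ᵀ) =
      Matrix.fromBlocks _ _ _ _ + Matrix.fromBlocks _ _ _ _
    simp only [Matrix.fromBlocks_add, Matrix.conjTranspose_add, Matrix.transpose_add, neg_add]
  map_smul' c p := Subtype.ext <| Matrix.of.injective <| by
    change Matrix.fromBlocks (c • p.1.1) (-(c • Sym.toMatrix p.2)ᴴ) (c • Sym.toMatrix p.2)
      (-(c • p.1.1)ᵀ) = c • Matrix.fromBlocks _ _ _ _
    simp only [Matrix.fromBlocks_smul, Matrix.conjTranspose_smul, Matrix.transpose_smul, smul_neg,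
      star_trivial]
  left_inv _ := rfl
  right_inv Y := Subtype.ext <| Matrix.of.injective <| by
    have hY := (entries_mem_spLie_iff_toBlocks (Z := Matrix.of Y.1)).1 Y.2
    refine Eq.trans ?_ (Matrix.of Y.1).fromBlocks_toBlocks
    rw [hY.2.2.1, hY.2.2.2]
    rfl

theorem range_spLieEquiv_comp_inr :
    LinearMap.range ((spLie n).subtype ∘ₗ (spLieEquiv n).toLinearMap ∘ₗ LinearMap.inr ℝ _ _) =
      symLie n := by
  ext Y
  constructor
  · rintro ⟨S, rfl⟩
    refine entries_fromBlocks_mem_symLie_iff.2 ⟨rfl, Matrix.ext fun i j => S.2 j i, rfl, ?_⟩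
    exact neg_eq_zero.2 rfl
  · intro hY
    obtain ⟨p, hp⟩ := (spLieEquiv n).surjective ⟨Y, hY.1⟩
    have hpY : (spLieEquiv n p).1 = Y := congrArg Subtype.val hp
    have hp1 : p.1.1 = 0 := (entries_fromBlocks_mem_symLie_iff.1 (hpY ▸ hY)).1
    have hp2 : (0, p.2) = p := Prod.ext (Subtype.ext hp1.symm) rfl
    exact ⟨p.2, (congrArg (fun p => (spLieEquiv n p).1) hp2).trans hpY⟩

/-- Symmetric matrices as functions of unordered pairs. -/
def symEquivSym2 (n : ℕ) : Sym n ≃ₗ[ℝ] (Sym2 (Fin n) → ℂ) where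
  toFun S := Sym2.lift ⟨S.1, S.2⟩
  invFun s := ⟨fun i j => s s(i, j), fun _ _ => congrArg s Sym2.eq_swap⟩
  map_add' _ _ := funext <| Sym2.ind fun _ _ => rfl
  map_smul' _ _ := funext <| Sym2.ind fun _ _ => rfl
  left_inv _ := rfl
  right_inv _ := funext <| Sym2.ind fun _ _ => rfl

theorem finrank_Sym : Module.finrank ℝ (Sym n) = n * (n + 1) := by
  rw [(symEquivSym2 n).finrank_eq, Module.finrank_pi_fintype]
  simp only [Complex.finrank_real_complex, Finset.sum_const, Finset.card_univ, Sym2.card,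
    Fintype.card_fin, smul_eq_mul, Nat.choose_two_right, Nat.add_sub_cancel]
  rw [Nat.div_mul_cancel (mul_comm n (n + 1) ▸ (Nat.even_mul_succ_self n).two_dvd), mul_comm]

theorem finrank_spLie : Module.finrank ℝ (spLie n) = n * (2 * n + 1) := by
  have : FiniteDimensional ℝ (skewAdjoint (Matrix (Fin n) (Fin n) ℂ)) :=
    finiteDimensional_skewAdjoint
  rw [← (spLieEquiv n).finrank_eq, Module.finrank_prod, finrank_skewAdjoint, finrank_Sym,
    Module.finrank_matrix, Fintype.card_fin, Module.finrank_self]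
  ring

theorem finrank_symLie : Module.finrank ℝ (symLie n) = n * (n + 1) := by
  rw [← range_spLieEquiv_comp_inr, ← finrank_Sym]
  exact LinearMap.finrank_range_of_inj
    (Subtype.val_injective.comp ((spLieEquiv n).injective.comp LinearMap.inr_injective))

end ComplexLagrangian

section OrthogonalForm

theorem orthogonal_eqLocus_id {K V : Type*} [Field K] [CharZero K] [AddCommGroup V] [Module K V]
    {B : LinearMap.BilinForm K V} (hB : B.Nondegenerate) {T : V →ₗ[K] V} (hT : ∀ v, T (T v) = v)
    (hTB : ∀ v w, B (T v) (T w) = -B v w) :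
    B.orthogonal (LinearMap.eqLocus T LinearMap.id) = LinearMap.eqLocus T LinearMap.id := by
  ext w
  simp only [LinearMap.BilinForm.mem_orthogonal_iff, LinearMap.mem_eqLocus, LinearMap.id_apply]
  refine ⟨fun hw => ?_, fun hw v hv => ?_⟩
  · refine (sub_eq_zero.1 (hB.2 _ fun v => ?_)).symm
    have hsum : B (v + T v) w = 0 := hw _ (by rw [map_add, hT, add_comm])
    have hswap : B v (T w) = -B (T v) w := by rw [← hTB, hT]
    rw [map_sub, hswap, sub_neg_eq_add, ← LinearMap.add_apply, ← map_add, hsum]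
  · have hanti := hTB v w
    rw [hv, hw] at hanti
    exact self_eq_neg.1 hanti

end OrthogonalForm

section Projection

theorem range_toLin'_mul_le {R k l m : Type*} [CommRing R] [Fintype k] [DecidableEq k] [Fintype l]
    [DecidableEq l] (M : Matrix m k R) (N : Matrix k l R) :
    LinearMap.range (Matrix.toLin' (M * N)) ≤ LinearMap.range (Matrix.toLin' M) := by
  rw [Matrix.toLin'_mul]
  exact LinearMap.range_comp_le_range _ _

theorem mul_eq_right_of_range_le {R k m : Type*} [CommRing R] [Fintype k] [DecidableEq k]
    [Fintype m] [DecidableEq m] {P : Matrix m m R} (hP : IsIdempotentElem P) {M : Matrix m k R}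
    (h : LinearMap.range (Matrix.toLin' M) ≤ LinearMap.range (Matrix.toLin' P)) : P * M = M := by
  refine Matrix.toLin'.injective (LinearMap.ext fun x => ?_)
  obtain ⟨y, hy⟩ := h ⟨x, rfl⟩
  rw [Matrix.toLin'_mul_apply, ← hy, ← Matrix.toLin'_mul_apply, hP.eq]

variable {𝕜 k m : Type*} [RCLike 𝕜] [Fintype k] [DecidableEq k] [Fintype m]

open scoped ComplexOrder in
theorem isUnit_conjTranspose_mul_self {M : Matrix m k 𝕜} {N : Matrix k m 𝕜} (h : N * M = 1) :
    IsUnit (Mᴴ * M) := by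
  refine (Matrix.PosDef.conjTranspose_mul_self M ?_).isUnit
  refine Function.LeftInverse.injective (g := N.mulVec) fun x => ?_
  rw [Matrix.mulVec_mulVec, h, Matrix.one_mulVec]

/-- The orthogonal projection onto the column space of a matrix of full column rank. -/
noncomputable def colProj (M : Matrix m k 𝕜) : Matrix m m 𝕜 := M * (Mᴴ * M)⁻¹ * Mᴴ

theorem colProj_of_conjTranspose_mul_self {M : Matrix m k 𝕜} (h : Mᴴ * M = 1) :
    colProj M = M * Mᴴ := by
  rw [colProj, h, inv_one, Matrix.mul_one]

theorem colProj_mul_self {M : Matrix m k 𝕜} (h : IsUnit (Mᴴ * M)) : colProj M * M = M := by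
  rw [colProj, Matrix.mul_assoc, Matrix.mul_assoc,
    Matrix.nonsing_inv_mul _ ((Matrix.isUnit_iff_isUnit_det _).1 h), Matrix.mul_one]

theorem isStarProjection_colProj {M : Matrix m k 𝕜} (h : IsUnit (Mᴴ * M)) :
    IsStarProjection (colProj M) where
  isIdempotentElem := by
    change colProj M * (M * (Mᴴ * M)⁻¹ * Mᴴ) = colProj M
    rw [Matrix.mul_assoc M, ← Matrix.mul_assoc, colProj_mul_self h, ← Matrix.mul_assoc, colProj]
  isSelfAdjoint := by
    change (colProj M)ᴴ = colProj M
    simp only [colProj, Matrix.conjTranspose_mul, Matrix.conjTranspose_conjTranspose,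
      Matrix.conjTranspose_nonsing_inv, Matrix.mul_assoc]

theorem exists_orthonormal_frame {r : ℕ} {W : Submodule 𝕜 (m → 𝕜)} (hr : Module.finrank 𝕜 W = r) :
    ∃ M : Matrix m (Fin r) 𝕜, Mᴴ * M = 1 ∧ LinearMap.range (Matrix.toLin' M) = W := by
  let e : (m → 𝕜) ≃ₗ[𝕜] EuclideanSpace 𝕜 m := (WithLp.linearEquiv 2 𝕜 (m → 𝕜)).symm
  have hr' : Module.finrank 𝕜 (W.map e.toLinearMap) = r := (e.finrank_map_eq W).trans hr
  let b := (stdOrthonormalBasis 𝕜 (W.map e.toLinearMap)).reindex (finCongr hr')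
  let M : Matrix m (Fin r) 𝕜 := Matrix.of fun a i => (b i).1.ofLp a
  have hMM : Mᴴ * M = 1 := by
    ext i j
    have h := orthonormal_iff_ite.1 b.orthonormal i j
    rw [Submodule.coe_inner, EuclideanSpace.inner_eq_star_dotProduct, dotProduct_comm] at h
    rw [Matrix.one_apply, ← h]
    rfl
  have hle : LinearMap.range (Matrix.toLin' M) ≤ W := by
    rw [Matrix.range_toLin', Submodule.span_le]
    rintro _ ⟨i, rfl⟩
    obtain ⟨v, hv, hvb⟩ := (b i).2
    have hvi : v = M.col i := congrArg WithLp.ofLp hvb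
    exact hvi ▸ hv
  refine ⟨M, hMM, Submodule.eq_of_le_of_finrank_eq hle ?_⟩
  have hinj : Function.Injective (Matrix.toLin' M) :=
    Function.LeftInverse.injective (g := Mᴴ.mulVec) fun x => by
      rw [Matrix.toLin'_apply, Matrix.mulVec_mulVec, hMM, Matrix.one_mulVec]
  rw [LinearMap.finrank_range_of_inj hinj, Module.finrank_fin_fun, hr]

/-- The matrix of the orthogonal projection onto a subspace of `𝕜ᵐ`. -/
noncomputable def orthProj (W : Submodule 𝕜 (m → 𝕜)) : Matrix m m 𝕜 :=
  colProj (exists_orthonormal_frame (W := W) rfl).choose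

theorem isStarProjection_orthProj (W : Submodule 𝕜 (m → 𝕜)) : IsStarProjection (orthProj W) :=
  isStarProjection_colProj <| isUnit_conjTranspose_mul_self
    (exists_orthonormal_frame (W := W) rfl).choose_spec.1

section DecidableEq

variable [DecidableEq m]

theorem range_colProj {M : Matrix m k 𝕜} (h : IsUnit (Mᴴ * M)) :
    LinearMap.range (Matrix.toLin' (colProj M)) = LinearMap.range (Matrix.toLin' M) := by
  apply le_antisymm
  · rw [colProj, Matrix.mul_assoc]
    exact range_toLin'_mul_le _ _
  · conv_lhs => rw [← colProj_mul_self h]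
    exact range_toLin'_mul_le _ _

theorem eq_of_isStarProjection_of_range_eq {P P' : Matrix m m 𝕜} (hP : IsStarProjection P)
    (hP' : IsStarProjection P')
    (h : LinearMap.range (Matrix.toLin' P) = LinearMap.range (Matrix.toLin' P')) : P = P' := by
  have hPP' : P * P' = P' := mul_eq_right_of_range_le hP.isIdempotentElem h.ge
  have hP'P : P' * P = P := mul_eq_right_of_range_le hP'.isIdempotentElem h.le
  rw [← hP'P, ← hP.isSelfAdjoint.star_eq, ← hP'.isSelfAdjoint.star_eq, ← star_mul, hPP']

theorem range_orthProj (W : Submodule 𝕜 (m → 𝕜)) :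
    LinearMap.range (Matrix.toLin' (orthProj W)) = W := by
  obtain ⟨hM, hW⟩ := (exists_orthonormal_frame (W := W) rfl).choose_spec
  exact (range_colProj (isUnit_conjTranspose_mul_self hM)).trans hW

theorem orthProj_range {P : Matrix m m 𝕜} (hP : IsStarProjection P) :
    orthProj (LinearMap.range (Matrix.toLin' P)) = P :=
  eq_of_isStarProjection_of_range_eq (isStarProjection_orthProj _) hP (range_orthProj _)

theorem isStarProjection_inv_two_smul_one_add {T : Matrix m m 𝕜} (hT : Tᴴ = T) (hTT : T * T = 1) :
    IsStarProjection ((2⁻¹ : 𝕜) • (1 + T)) where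
  isIdempotentElem := by
    have hsq : (1 + T) * (1 + T) = (2 : 𝕜) • (1 + T) := by
      rw [add_mul, mul_add T, hTT, one_mul, mul_one, add_comm T 1, two_smul]
    rw [IsIdempotentElem, smul_mul_smul_comm, hsq, smul_smul, mul_assoc,
      inv_mul_cancel₀ two_ne_zero, mul_one]
  isSelfAdjoint := by
    rw [IsSelfAdjoint, Matrix.star_eq_conjTranspose, Matrix.conjTranspose_smul,
      Matrix.conjTranspose_add, hT, Matrix.conjTranspose_one, star_inv₀, star_ofNat]

theorem range_inv_two_smul_one_add {T : Matrix m m 𝕜} (hTT : T * T = 1) :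
    LinearMap.range (Matrix.toLin' ((2⁻¹ : 𝕜) • (1 + T))) =
      LinearMap.eqLocus (Matrix.toLin' T) LinearMap.id := by
  ext v
  rw [LinearMap.mem_eqLocus, LinearMap.id_apply]
  constructor
  · rintro ⟨w, rfl⟩
    rw [← Matrix.toLin'_mul_apply, mul_smul_comm, mul_add, mul_one, hTT, add_comm]
  · intro hv
    refine ⟨v, ?_⟩
    rw [map_smul, LinearMap.smul_apply, map_add, LinearMap.add_apply, hv, Matrix.toLin'_one,
      LinearMap.id_apply, ← two_smul 𝕜 v, smul_smul, inv_mul_cancel₀ two_ne_zero, one_smul]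

end DecidableEq

theorem orthProj_range_eq_colProj {M : Matrix m k 𝕜} (h : IsUnit (Mᴴ * M)) :
    orthProj (LinearMap.range (Matrix.toLin' M)) = colProj M := by
  classical
  rw [← range_colProj h, orthProj_range (isStarProjection_colProj h)]

end Projection

theorem mul_inv_map_eq_iff {G : Type*} [Group G] (f : G →* G) {g h : G} :
    g * (f g)⁻¹ = h * (f h)⁻¹ ↔ f (g⁻¹ * h) = g⁻¹ * h := by
  rw [map_mul, map_inv, ← eq_inv_mul_iff_mul_eq, ← mul_assoc, eq_mul_inv_iff_mul_eq]

namespace ComplexLagrangian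

variable {n : ℕ}

theorem involution_unitaryEmbedding (A : Matrix.unitaryGroup (Fin n) ℂ) :
    involution n (unitaryEmbedding n A) = unitaryEmbedding n A :=
  Subtype.ext <| by simp [unitaryEmbedding, involution, Inn, Matrix.fromBlocks_multiply]

theorem eq_fromBlocks_of_Inn_mul_mul_Inn {X : BlockMat n} (h : Inn n * X * Inn n = X) :
    X = Matrix.fromBlocks X.toBlocks₁₁ 0 0 X.toBlocks₂₂ := by
  rw [← Matrix.fromBlocks_toBlocks X] at h ⊢
  simp only [Inn, Matrix.fromBlocks_multiply, Matrix.fromBlocks_inj, mul_zero, zero_mul, mul_one,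
    one_mul, mul_neg, neg_mul, zero_add, add_zero] at h
  have eq_zero {b : Matrix (Fin n) (Fin n) ℂ} (hb : -b = b) : b = 0 :=
    Matrix.ext fun i j => self_eq_neg.1 (congrFun₂ hb i j).symm
  rw [Matrix.fromBlocks_inj]
  exact ⟨rfl, eq_zero h.2.1, eq_zero h.2.2.1, rfl⟩

theorem fromBlocks_zero_zero_mem_Sp_iff {a d : Matrix (Fin n) (Fin n) ℂ} :
    Matrix.fromBlocks a 0 0 d ∈ Sp n ↔ aᴴ * a = 1 ∧ d = a.map star := by
  constructor
  · intro h
    rw [mem_Sp_iff, Matrix.J] at h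
    simp only [Matrix.fromBlocks_conjTranspose, Matrix.fromBlocks_transpose,
      ← Matrix.fromBlocks_one, Matrix.fromBlocks_multiply, Matrix.fromBlocks_inj, mul_zero,
      zero_mul, mul_one, mul_neg, neg_mul, zero_add, add_zero, neg_inj, Matrix.conjTranspose_zero,
      Matrix.transpose_zero] at h
    obtain ⟨⟨ha, -⟩, -, had, -⟩ := h
    have hconj : a.map star * aᵀ = 1 := by
      rw [← Matrix.transpose_inj, Matrix.transpose_mul, Matrix.transpose_transpose,
        Matrix.transpose_one]
      exact mul_eq_one_comm.1 ha
    refine ⟨ha, ?_⟩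
    rw [← mul_one (a.map star), ← had, ← mul_assoc, hconj, one_mul]
  · rintro ⟨ha, rfl⟩
    exact fromBlocks_mem_Sp ⟨a, Matrix.mem_unitaryGroup_iff'.2 ha⟩

theorem mem_U_iff {Q : Sp n} : Q ∈ U n ↔ involution n Q = Q := by
  constructor
  · rintro ⟨A, rfl⟩
    exact involution_unitaryEmbedding A
  · intro h
    have hblocks := eq_fromBlocks_of_Inn_mul_mul_Inn (congrArg Subtype.val h)
    obtain ⟨hu, hd⟩ := fromBlocks_zero_zero_mem_Sp_iff.1 (hblocks ▸ Q.2)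
    rw [hd] at hblocks
    exact ⟨⟨Q.1.toBlocks₁₁, Matrix.mem_unitaryGroup_iff'.2 hu⟩, Subtype.ext hblocks.symm⟩

theorem mul_lagAdj_eq_iff {Q R : Sp n} :
    Q.1 * lagAdj Q.1 = R.1 * lagAdj R.1 ↔ Q⁻¹ * R ∈ U n := by
  rw [mul_lagAdj_coe, mul_lagAdj_coe, Subtype.coe_inj, mul_inv_map_eq_iff, mem_U_iff]

theorem omega_apply (v w : Fin n ⊕ Fin n → ℂ) :
    omega n v w = v ⬝ᵥ Matrix.J (Fin n) ℂ *ᵥ w := by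
  rw [omega, Matrix.toBilin'_apply']

theorem transpose_mul_J_mul_apply {k : Type*} (M N : Matrix (Fin n ⊕ Fin n) k ℂ) (i j : k) :
    (Mᵀ * Matrix.J (Fin n) ℂ * N) i j = omega n (M.col i) (N.col j) := by
  rw [omega_apply, Matrix.mul_assoc, Matrix.mul_apply']
  rfl

theorem omega_nondegenerate : (omega n).Nondegenerate :=
  Matrix.nondegenerate_toBilin'_iff.2
    (Matrix.nondegenerate_of_det_ne_zero (Matrix.isUnit_det_J _ _).ne_zero)

theorem LGr.eq_of_le {L L' : LGr n} (h : L.1 ≤ L'.1) : L = L' := by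
  refine Subtype.ext (le_antisymm h ?_)
  rw [← L.2, ← L'.2]
  exact LinearMap.BilinForm.orthogonal_le h

theorem LGr.transpose_mul_J_mul_eq_zero (L : LGr n) {k : Type*} [Fintype k] [DecidableEq k]
    {M : Matrix (Fin n ⊕ Fin n) k ℂ} (h : LinearMap.range (Matrix.toLin' M) ≤ L.1) :
    Mᵀ * Matrix.J (Fin n) ℂ * M = 0 := by
  have hcol (i : k) : M.col i ∈ L.1 := h ⟨Pi.single i 1, by simp⟩
  ext i j
  rw [transpose_mul_J_mul_apply]
  exact LinearMap.BilinForm.mem_orthogonal_iff.1 (L.2.ge (hcol j)) _ (hcol i)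

theorem LGr.finrank_eq (L : LGr n) : Module.finrank ℂ L.1 = n := by
  have h := LinearMap.BilinForm.finrank_orthogonal (omega_nondegenerate (n := n)) L.1
  have hle := Submodule.finrank_le L.1
  have hself : Module.finrank ℂ ((omega n).orthogonal L.1) = Module.finrank ℂ L.1 := by rw [L.2]
  rw [hself] at h
  simp only [Module.finrank_fintype_fun_eq_card, Fintype.card_sum, Fintype.card_fin] at h hle
  omega

/-- The `2n × n` matrix `(I; S)`, whose columns span the graph of `S`. -/
def graphFrame (S : Matrix (Fin n) (Fin n) ℂ) : Matrix (Fin n ⊕ Fin n) (Fin n) ℂ :=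
  Matrix.fromRows 1 S

theorem conjTranspose_graphFrame_mul (S T : Matrix (Fin n) (Fin n) ℂ) :
    (graphFrame S)ᴴ * graphFrame T = 1 + Sᴴ * T := by
  rw [graphFrame, graphFrame, Matrix.conjTranspose_fromRows_eq_fromCols_conjTranspose,
    Matrix.fromCols_mul_fromRows, Matrix.conjTranspose_one, one_mul]

theorem LGr.coe_param (A : Matrix.symplecticGroup (Fin n) ℂ) (S : Sym n) :
    (LGr.param A S).1 = LinearMap.range (Matrix.toLin' (A.1 * graphFrame (Sym.toMatrix S))) := by
  rw [Matrix.toLin'_mul, LinearMap.range_comp]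
  rfl

/-- The `2n × n` matrix `(I; 0)`, whose columns span `ℂⁿ × {0}`. -/
def stdFrame (n : ℕ) : Matrix (Fin n ⊕ Fin n) (Fin n) ℂ := graphFrame 0

theorem conjTranspose_graphFrame_mul_stdFrame (S : Matrix (Fin n) (Fin n) ℂ) :
    (graphFrame S)ᴴ * stdFrame n = 1 := by
  rw [stdFrame, conjTranspose_graphFrame_mul, mul_zero, add_zero]

theorem two_smul_stdFrame_mul_conjTranspose_sub_one :
    (2 : ℂ) • (stdFrame n * (stdFrame n)ᴴ) - 1 = Inn n := by
  rw [stdFrame, graphFrame, Matrix.conjTranspose_fromRows_eq_fromCols_conjTranspose,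
    Matrix.fromRows_mul_fromCols, two_smul, sub_eq_iff_eq_add, Inn, ← Matrix.fromBlocks_one,
    Matrix.fromBlocks_add, Matrix.fromBlocks_add]
  simp

theorem LGr.coe_act_std (A : Matrix.symplecticGroup (Fin n) ℂ) :
    (LGr.act A (LGr.std n)).1 = LinearMap.range (Matrix.toLin' (A.1 * stdFrame n)) :=
  LGr.coe_param A 0

theorem J_conjTranspose : (Matrix.J (Fin n) ℂ)ᴴ = -Matrix.J (Fin n) ℂ := by
  simp [Matrix.J, Matrix.fromBlocks_conjTranspose, Matrix.fromBlocks_neg]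

/-- The quaternionic structure `v ↦ J v̄` of `ℂ²ⁿ` completes a Lagrangian orthonormal frame to an
element of `Sp(n)`. -/
theorem fromCols_J_mul_map_star_mem_Sp {M : Matrix (Fin n ⊕ Fin n) (Fin n) ℂ} (hM : Mᴴ * M = 1)
    (hMJ : Mᵀ * Matrix.J (Fin n) ℂ * M = 0) :
    Matrix.fromCols M (Matrix.J (Fin n) ℂ * M.map star) ∈ Sp n := by
  have hMc : Mᵀ * M.map star = 1 := by
    rw [← Matrix.transpose_inj, Matrix.transpose_mul, Matrix.transpose_one]
    exact hM
  have hMJc : Mᴴ * (Matrix.J (Fin n) ℂ * M.map star) = 0 := by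
    have h := congrArg Matrix.conjTranspose hMJ
    rw [Matrix.conjTranspose_mul, Matrix.conjTranspose_mul, J_conjTranspose,
      Matrix.neg_mul, Matrix.mul_neg, Matrix.conjTranspose_zero, neg_eq_zero] at h
    exact h
  have hstar : (M.map star)ᴴ = Mᵀ := by ext; simp
  have hMtc : (M.map star)ᵀ = Mᴴ := rfl
  have hJJ (X : Matrix (Fin n ⊕ Fin n) (Fin n) ℂ) :
      Matrix.J (Fin n) ℂ * (Matrix.J (Fin n) ℂ * X) = -X := by
    rw [← Matrix.mul_assoc, Matrix.J_squared, Matrix.neg_mul, Matrix.one_mul]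
  rw [Matrix.mul_assoc] at hMJ
  rw [mem_Sp_iff, mul_one, Matrix.conjTranspose_fromCols_eq_fromRows_conjTranspose,
    Matrix.transpose_fromCols, Matrix.fromRows_mul_fromCols, Matrix.fromRows_mul,
    Matrix.fromRows_mul_fromCols]
  simp only [Matrix.conjTranspose_mul, Matrix.transpose_mul, J_conjTranspose, Matrix.J_transpose,
    hstar, hMtc, Matrix.mul_assoc, Matrix.neg_mul, Matrix.mul_neg, hJJ, hM, hMJ, hMc, hMJc]
  simp [Matrix.J]

theorem LGr.exists_act_std_eq (L : LGr n) :
    ∃ Q : Sp n, LGr.act (toSymplectic Q) (LGr.std n) = L := by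
  obtain ⟨M, hM, hML⟩ := exists_orthonormal_frame L.finrank_eq
  let Q : Sp n := ⟨_, fromCols_J_mul_map_star_mem_Sp hM (L.transpose_mul_J_mul_eq_zero hML.le)⟩
  have hQ : Q.1 * stdFrame n = M := by
    rw [stdFrame, graphFrame, Matrix.fromCols_mul_fromRows, Matrix.mul_one, Matrix.mul_zero,
      add_zero]
  refine ⟨Q, Subtype.ext ?_⟩
  rw [LGr.coe_act_std, ← hML, ← hQ]
  rfl

theorem LGr.act_act (A B : Sp n) (L : LGr n) :
    LGr.act (toSymplectic A) (LGr.act (toSymplectic B) L) = LGr.act (toSymplectic (A * B)) L := by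
  refine Subtype.ext ?_
  change Submodule.map _ (Submodule.map _ _) = Submodule.map (Matrix.toLin' (A.1 * B.1)) _
  rw [Matrix.toLin'_mul, Submodule.map_comp]
  rfl

/-- The product `R_L I_{n,n}`, where `R_L` is the orthogonal reflection in the Lagrangian subspace
`L`. It sends `Q (ℂⁿ × {0})` to `Q Q^L`. -/
noncomputable def LGr.toMat (L : LGr n) : BlockMat n := ((2 : ℂ) • orthProj L.1 - 1) * Inn n

/-- The matrix `P` with `X = (2 P - 1) I_{n,n}`: the orthogonal projection onto the Lagrangian
subspace that corresponds to `X`. -/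
noncomputable def matProj (X : BlockMat n) : BlockMat n := (2⁻¹ : ℂ) • (1 + X * Inn n)

theorem matProj_two_smul_sub_one_mul_Inn (P : BlockMat n) :
    matProj (((2 : ℂ) • P - 1) * Inn n) = P := by
  rw [matProj, mul_assoc, Inn_mul_Inn, mul_one, add_sub_cancel, smul_smul,
    inv_mul_cancel₀ two_ne_zero, one_smul]

theorem two_smul_matProj_sub_one_mul_Inn (X : BlockMat n) :
    ((2 : ℂ) • matProj X - 1) * Inn n = X := by
  rw [matProj, smul_smul, mul_inv_cancel₀ two_ne_zero, one_smul, add_sub_cancel_left, mul_assoc,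
    Inn_mul_Inn, mul_one]

theorem LGr.matProj_toMat (L : LGr n) : matProj L.toMat = orthProj L.1 :=
  matProj_two_smul_sub_one_mul_Inn _

theorem LGr.toMat_injective : Function.Injective (LGr.toMat (n := n)) := fun L L' h => by
  refine Subtype.ext ?_
  rw [← range_orthProj L.1, ← range_orthProj L'.1, ← L.matProj_toMat, ← L'.matProj_toMat, h]

theorem LGr.orthProj_act_std (Q : Sp n) : orthProj (LGr.act (toSymplectic Q) (LGr.std n)).1 =
    Q.1 * (stdFrame n * (stdFrame n)ᴴ) * Q.1ᴴ := by
  have hQ : Q.1ᴴ * Q.1 = 1 := Matrix.mem_unitaryGroup_iff'.1 Q.2.1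
  have hframe : (Q.1 * stdFrame n)ᴴ * (Q.1 * stdFrame n) = 1 := by
    calc _ = (stdFrame n)ᴴ * (Q.1ᴴ * Q.1) * stdFrame n := by
          simp only [Matrix.conjTranspose_mul, Matrix.mul_assoc]
      _ = 1 := by
          rw [hQ, Matrix.mul_one]
          exact conjTranspose_graphFrame_mul_stdFrame 0
  have hproj := orthProj_range_eq_colProj (isUnit_conjTranspose_mul_self hframe)
  rw [colProj_of_conjTranspose_mul_self hframe] at hproj
  rw [LGr.coe_act_std]
  refine hproj.trans ?_
  simp only [Matrix.conjTranspose_mul, Matrix.mul_assoc]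

theorem LGr.toMat_act_std (Q : Sp n) :
    (LGr.act (toSymplectic Q) (LGr.std n)).toMat = Q.1 * lagAdj Q.1 := by
  have hQ : Q.1 * Q.1ᴴ = 1 := Matrix.mem_unitaryGroup_iff.1 Q.2.1
  have hrefl : (2 : ℂ) • (Q.1 * (stdFrame n * (stdFrame n)ᴴ) * Q.1ᴴ) - 1 =
      Q.1 * Inn n * Q.1ᴴ := by
    rw [← two_smul_stdFrame_mul_conjTranspose_sub_one, mul_sub, sub_mul, mul_one, hQ,
      mul_smul_comm, smul_mul_assoc]
  rw [LGr.toMat, LGr.orthProj_act_std, hrefl, lagAdj]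
  simp only [mul_assoc]

theorem LGr.range_toMat : Set.range (LGr.toMat (n := n)) = QQL n := by
  ext X
  constructor
  · rintro ⟨L, rfl⟩
    obtain ⟨Q, rfl⟩ := L.exists_act_std_eq
    exact ⟨Q, Q.2, LGr.toMat_act_std Q⟩
  · rintro ⟨Q, hQ, rfl⟩
    exact ⟨_, LGr.toMat_act_std ⟨Q, hQ⟩⟩

theorem conjTranspose_mul_Inn {X : BlockMat n} (h : X = lagAdj X) :
    (X * Inn n)ᴴ = X * Inn n := by
  conv_rhs => rw [h, lagAdj, mul_assoc, Inn_mul_Inn, mul_one]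
  rw [Matrix.conjTranspose_mul, Inn_conjTranspose]

theorem mul_Inn_mul_mul_Inn {X : BlockMat n} (hX : X ∈ Sp n) (h : X = lagAdj X) :
    X * Inn n * (X * Inn n) = 1 := by
  calc X * Inn n * (X * Inn n) = (X * Inn n)ᴴ * (X * Inn n) := by rw [conjTranspose_mul_Inn h]
    _ = Inn n * (Xᴴ * 1 * X) * Inn n := by
        rw [Matrix.conjTranspose_mul, Inn_conjTranspose]; noncomm_ring
    _ = 1 := by rw [(mem_Sp_iff.1 hX).1, mul_one, Inn_mul_Inn]

theorem omega_mul_Inn_mulVec {X : BlockMat n} (hX : X ∈ Sp n) (v w : Fin n ⊕ Fin n → ℂ) :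
    omega n ((X * Inn n) *ᵥ v) ((X * Inn n) *ᵥ w) = -omega n v w := by
  have hJ : (Inn n)ᵀ * Matrix.J (Fin n) ℂ * Inn n = -Matrix.J (Fin n) ℂ := by
    rw [Inn_transpose, Inn_mul_J_mul_Inn]
  rw [← Matrix.mulVec_mulVec, ← Matrix.mulVec_mulVec, omega_mulVec ⟨X, hX.2⟩, omega_apply,
    omega_apply, ← dotProduct_neg, ← Matrix.neg_mulVec, ← hJ, ← Matrix.mulVec_mulVec,
    ← Matrix.mulVec_mulVec, Matrix.dotProduct_mulVec v, Matrix.vecMul_transpose]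

theorem orthogonal_range_matProj {X : BlockMat n} (hX : X ∈ Sp n) (h : X = lagAdj X) :
    (omega n).orthogonal (LinearMap.range (Matrix.toLin' (matProj X))) =
      LinearMap.range (Matrix.toLin' (matProj X)) := by
  have hsq := mul_Inn_mul_mul_Inn hX h
  rw [matProj, range_inv_two_smul_one_add hsq]
  refine orthogonal_eqLocus_id omega_nondegenerate (fun v => ?_) (omega_mul_Inn_mulVec hX)
  rw [← Matrix.toLin'_mul_apply, hsq, Matrix.toLin'_one, LinearMap.id_apply]

theorem LGr.exists_toMat_eq {X : BlockMat n} (hX : X ∈ Sp n) (h : X = lagAdj X) :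
    ∃ L : LGr n, L.toMat = X := by
  refine ⟨⟨_, orthogonal_range_matProj hX h⟩, ?_⟩
  have hproj : orthProj (LinearMap.range (Matrix.toLin' (matProj X))) = matProj X :=
    orthProj_range (isStarProjection_inv_two_smul_one_add (conjTranspose_mul_Inn h)
      (mul_Inn_mul_mul_Inn hX h))
  change ((2 : ℂ) • orthProj (LinearMap.range (Matrix.toLin' (matProj X))) - 1) * Inn n = X
  rw [hproj, two_smul_matProj_sub_one_mul_Inn]

theorem mem_QQL_iff {X : BlockMat n} : X ∈ QQL n ↔ X ∈ Sp n ∧ X = lagAdj X := by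
  constructor
  · rintro ⟨Q, hQ, rfl⟩
    refine ⟨?_, by rw [lagAdj_mul, lagAdj_lagAdj]⟩
    rw [mul_lagAdj_coe ⟨Q, hQ⟩]
    exact Subtype.property _
  · rintro ⟨hX, h⟩
    rw [← LGr.range_toMat]
    exact LGr.exists_toMat_eq hX h

end ComplexLagrangian

open Filter Topology in
theorem isEmbedding_of_eventually_leftInverse {X Y : Type*} [TopologicalSpace X]
    [TopologicalSpace Y] {f : X → Y} (hf : Continuous f) (hinj : Function.Injective f)
    (h : ∀ x, ∃ g : Y → X, ContinuousAt g (f x) ∧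
      ∀ᶠ y in 𝓝 (f x), ∀ x', f x' = y → g y = x') : IsEmbedding f := by
  refine ⟨isInducing_iff_nhds.2 fun x => le_antisymm hf.continuousAt.le_comap ?_, hinj⟩
  obtain ⟨g, hg, hleft⟩ := h x
  have hgx : g (f x) = x := hleft.self_of_nhds x rfl
  have hgf : Tendsto (g ∘ f) (comap f (𝓝 (f x))) (𝓝 x) := by
    simpa only [hgx] using hg.tendsto.comp tendsto_comap
  refine hgf.congr' ?_
  filter_upwards [preimage_mem_comap hleft] with x' hx'
  exact hx' x' rfl

namespace ComplexLagrangian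

variable {n : ℕ} (A : Matrix.symplecticGroup (Fin n) ℂ)

theorem coe_inv_mul_coe : A⁻¹.1 * A.1 = 1 := congrArg Subtype.val (inv_mul_cancel A)

theorem coe_mul_coe_inv : A.1 * A⁻¹.1 = 1 := congrArg Subtype.val (mul_inv_cancel A)

theorem isUnit_conjTranspose_mul_self_graphFrame (T : Matrix (Fin n) (Fin n) ℂ) :
    IsUnit ((A.1 * graphFrame T)ᴴ * (A.1 * graphFrame T)) := by
  refine isUnit_conjTranspose_mul_self (N := (stdFrame n)ᴴ * A⁻¹.1) ?_
  rw [Matrix.mul_assoc, ← Matrix.mul_assoc _ A.1, coe_inv_mul_coe, Matrix.one_mul, stdFrame,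
    conjTranspose_graphFrame_mul, Matrix.conjTranspose_zero, Matrix.zero_mul, add_zero]

theorem LGr.orthProj_param (S : Sym n) :
    orthProj (LGr.param A S).1 = colProj (A.1 * graphFrame (Sym.toMatrix S)) := by
  rw [LGr.coe_param]
  exact orthProj_range_eq_colProj (isUnit_conjTranspose_mul_self_graphFrame A _)

/-- The matrix `A⁻¹ P A⁻ᴴ (I; 0)`, where `P = matProj X`. For the Lagrangian subspace `L` that
corresponds to `X`, its columns lie in `A⁻¹ L`, and they span it if `A⁻¹ L` is a graph. -/
noncomputable def paramFrame (X : BlockMat n) : Matrix (Fin n ⊕ Fin n) (Fin n) ℂ :=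
  A⁻¹.1 * matProj X * A⁻¹.1ᴴ * stdFrame n

theorem paramFrame_toMat_param (S : Sym n) : paramFrame A (LGr.param A S).toMat =
    graphFrame (Sym.toMatrix S) * ((A.1 * graphFrame (Sym.toMatrix S))ᴴ *
      (A.1 * graphFrame (Sym.toMatrix S)))⁻¹ := by
  have hA : A.1ᴴ * A⁻¹.1ᴴ = 1 := by
    rw [← Matrix.conjTranspose_mul, coe_inv_mul_coe, Matrix.conjTranspose_one]
  rw [paramFrame, LGr.matProj_toMat, LGr.orthProj_param, colProj]
  generalize ((A.1 * graphFrame (Sym.toMatrix S))ᴴ * (A.1 * graphFrame (Sym.toMatrix S)))⁻¹ = G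
  calc _ = (A⁻¹.1 * A.1) * graphFrame (Sym.toMatrix S) * G *
        ((graphFrame (Sym.toMatrix S))ᴴ * (A.1ᴴ * A⁻¹.1ᴴ) * stdFrame n) := by
        simp only [Matrix.conjTranspose_mul, Matrix.mul_assoc]
    _ = graphFrame (Sym.toMatrix S) * G := by
        rw [hA, coe_inv_mul_coe, Matrix.mul_one, conjTranspose_graphFrame_mul_stdFrame,
          Matrix.mul_one, Matrix.one_mul]

/-- The matrix `T` such that the columns of `paramFrame A X` span the graph of `T`, meaningful
where the upper half of `paramFrame A X` is invertible. -/
noncomputable def paramSlope (X : BlockMat n) : Matrix (Fin n) (Fin n) ℂ :=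
  (paramFrame A X).toRows₂ * (paramFrame A X).toRows₁⁻¹

/-- The matrices that correspond to Lagrangian subspaces parametrized by `LGr.param A`. -/
def paramTarget : Set (Entries n) :=
  {X | IsUnit (paramFrame A (Matrix.of X)).toRows₁}

theorem isUnit_inv_conjTranspose_mul_self_graphFrame (T : Matrix (Fin n) (Fin n) ℂ) :
    IsUnit ((A.1 * graphFrame T)ᴴ * (A.1 * graphFrame T))⁻¹ :=
  Matrix.isUnit_nonsing_inv_iff.2 (isUnit_conjTranspose_mul_self_graphFrame A T)

theorem entries_toMat_param_mem_paramTarget (S : Sym n) :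
    entries (LGr.param A S).toMat ∈ paramTarget A := by
  change IsUnit (paramFrame A (LGr.param A S).toMat).toRows₁
  rw [paramFrame_toMat_param, graphFrame, Matrix.fromRows_mul, Matrix.toRows₁_fromRows,
    Matrix.one_mul]
  exact isUnit_inv_conjTranspose_mul_self_graphFrame A _

theorem paramSlope_toMat_param (S : Sym n) :
    paramSlope A (LGr.param A S).toMat = Sym.toMatrix S := by
  have hG := isUnit_inv_conjTranspose_mul_self_graphFrame A (Sym.toMatrix S)
  rw [paramSlope, paramFrame_toMat_param]
  generalize ((A.1 * graphFrame (Sym.toMatrix S))ᴴ * (A.1 * graphFrame (Sym.toMatrix S)))⁻¹ = G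
    at hG
  rw [graphFrame, Matrix.fromRows_mul, Matrix.toRows₁_fromRows, Matrix.toRows₂_fromRows,
    Matrix.one_mul, Matrix.mul_nonsing_inv_cancel_right _ _ ((Matrix.isUnit_iff_isUnit_det _).1 hG)]

variable {A} in
theorem mul_graphFrame_paramSlope {X : BlockMat n} (h : entries X ∈ paramTarget A) :
    A.1 * graphFrame (paramSlope A X) =
      matProj X * (A⁻¹.1ᴴ * stdFrame n * (paramFrame A X).toRows₁⁻¹) := by
  have hmul : (paramFrame A X).toRows₁ * (paramFrame A X).toRows₁⁻¹ = 1 :=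
    Matrix.mul_nonsing_inv _ ((Matrix.isUnit_iff_isUnit_det _).1 h)
  have hgraph : graphFrame (paramSlope A X) = paramFrame A X * (paramFrame A X).toRows₁⁻¹ := by
    conv_rhs => rw [← Matrix.fromRows_toRows (paramFrame A X), Matrix.fromRows_mul,
      Matrix.toRows₁_fromRows, hmul]
    rfl
  rw [hgraph, paramFrame]
  simp only [← Matrix.mul_assoc]
  rw [coe_mul_coe_inv, Matrix.one_mul]

variable {A} in
theorem range_mul_graphFrame_paramSlope_le {L : LGr n} (h : entries L.toMat ∈ paramTarget A) :
    LinearMap.range (Matrix.toLin' (A.1 * graphFrame (paramSlope A L.toMat))) ≤ L.1 := by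
  rw [mul_graphFrame_paramSlope h, LGr.matProj_toMat]
  exact (range_toLin'_mul_le _ _).trans (range_orthProj L.1).le

variable {A} in
theorem transpose_eq_of_range_mul_graphFrame_le {T : Matrix (Fin n) (Fin n) ℂ} {L : LGr n}
    (h : LinearMap.range (Matrix.toLin' (A.1 * graphFrame T)) ≤ L.1) : Tᵀ = T := by
  have hJ : (graphFrame T)ᵀ * Matrix.J (Fin n) ℂ * graphFrame T = 0 := by
    rw [← SymplecticGroup.mem_iff'.1 A.2, ← L.transpose_mul_J_mul_eq_zero h]
    simp only [Matrix.transpose_mul, Matrix.mul_assoc]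
  rw [graphFrame, Matrix.transpose_fromRows, Matrix.J, Matrix.fromCols_mul_fromBlocks,
    Matrix.fromCols_mul_fromRows] at hJ
  simpa [add_neg_eq_zero] using hJ

/-- The real linear projection of the space of all complex matrices onto the symmetric ones. -/
noncomputable def symmetrize (n : ℕ) : (Fin n → Fin n → ℂ) →ₗ[ℝ] Sym n where
  toFun T := ⟨fun i j => 2⁻¹ * (T i j + T j i), fun i j => congrArg (2⁻¹ * ·) (add_comm _ _)⟩
  map_add' S T := by
    ext i j
    simp only [Submodule.coe_add, Pi.add_apply]
    ring
  map_smul' c T := by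
    ext i j
    simp only [SetLike.val_smul, Pi.smul_apply, RingHom.id_apply, Complex.real_smul]
    ring

theorem symmetrize_coe (S : Sym n) : symmetrize n S.1 = S := by
  ext i j
  change 2⁻¹ * (S.1 i j + S.1 j i) = S.1 i j
  rw [S.2 j i, ← two_mul, inv_mul_cancel_left₀ two_ne_zero]

theorem toMatrix_symmetrize {T : Matrix (Fin n) (Fin n) ℂ} (h : Tᵀ = T) :
    Sym.toMatrix (symmetrize n (Matrix.of.symm T)) = T :=
  congrArg Sym.toMatrix (symmetrize_coe ⟨Matrix.of.symm T, fun i j => congrFun₂ h.symm i j⟩)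

/-- The inverse of the parametrization `LGr.param A`, in terms of the matrices `LGr.toMat L`. -/
noncomputable def paramInv (X : BlockMat n) : Sym n :=
  symmetrize n (Matrix.of.symm (paramSlope A X))

theorem paramInv_toMat_param (S : Sym n) : paramInv A (LGr.param A S).toMat = S := by
  rw [paramInv, paramSlope_toMat_param]
  exact symmetrize_coe S

variable {A} in
theorem param_paramInv {L : LGr n} (h : entries L.toMat ∈ paramTarget A) :
    LGr.param A (paramInv A L.toMat) = L := by
  have hrange := range_mul_graphFrame_paramSlope_le h
  refine LGr.eq_of_le ?_
  rwa [LGr.coe_param, paramInv,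
    toMatrix_symmetrize (transpose_eq_of_range_mul_graphFrame_le hrange)]

theorem entrywiseContDiffAt_paramFrame (X : Entries n) :
    EntrywiseContDiffAt ℝ ∞ (fun X : Entries n => paramFrame A (Matrix.of X)) X :=
  (((EntrywiseContDiffAt.const _).mul
    (((EntrywiseContDiffAt.const 1).add (.mul .of_id (.const _))).const_smul _)).mul
      (.const _)).mul (.const _)

theorem isOpen_paramTarget : IsOpen (paramTarget A) := by
  refine isOpen_setOf_isUnit_matrix (continuous_iff_continuousAt.2 fun X => ?_)
  exact (EntrywiseContDiffAt.contDiffAt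
    fun i j => entrywiseContDiffAt_paramFrame A X (Sum.inl i) j).continuousAt

variable {A} in
theorem contDiffAt_paramInv {X : Entries n} (h : X ∈ paramTarget A) :
    ContDiffAt ℝ ∞ (fun X : Entries n => paramInv A (Matrix.of X)) X := by
  have hframe := entrywiseContDiffAt_paramFrame A X
  have hslope : EntrywiseContDiffAt ℝ ∞ (fun X : Entries n => paramSlope A (Matrix.of X)) X :=
    EntrywiseContDiffAt.mul (fun i j => hframe (Sum.inr i) j)
      (.inv (fun i j => hframe (Sum.inl i) j) h)
  exact (symmetrize n).toContinuousLinearMap.contDiff.contDiffAt.comp X hslope.contDiffAt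

/-- The embedding of the Lagrangian Grassmannian in the space of matrices. -/
noncomputable def LGr.emb (L : LGr n) : Entries n := entries L.toMat

theorem LGr.contDiff_emb_param : ContDiff ℝ ∞ fun S : Sym n => (LGr.param A S).emb := by
  refine contDiff_iff_contDiffAt.2 fun S => ?_
  have hgraph : EntrywiseContDiffAt ℝ ∞ (fun S : Sym n => graphFrame (Sym.toMatrix S)) S := by
    rintro (i | i) j
    · exact contDiffAt_const
    · exact EntrywiseContDiffAt.of_contDiffAt (Sym n).subtypeL.contDiff.contDiffAt i j
  have hframe := (EntrywiseContDiffAt.const A.1).mul hgraph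
  have hproj : EntrywiseContDiffAt ℝ ∞
      (fun S : Sym n => colProj (A.1 * graphFrame (Sym.toMatrix S))) S :=
    (hframe.mul ((hframe.conjTranspose.mul hframe).inv
      (isUnit_conjTranspose_mul_self_graphFrame A _))).mul hframe.conjTranspose
  simp only [← LGr.orthProj_param] at hproj
  exact (((hproj.const_smul (2 : ℂ)).sub (.const 1)).mul (.const (Inn n))).contDiffAt

theorem LGr.continuous_param : Continuous (LGr.param A) :=
  continuous_iff_coinduced_le.2 (le_iSup (fun A : Matrix.symplecticGroup (Fin n) ℂ =>
    TopologicalSpace.coinduced (LGr.param A) inferInstance) A)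

theorem LGr.continuous_emb : Continuous (LGr.emb (n := n)) :=
  continuous_iSup_dom.2 fun A =>
    continuous_coinduced_dom.2 (LGr.contDiff_emb_param A).continuous

theorem LGr.exists_param_eq (L : LGr n) :
    ∃ (A : Matrix.symplecticGroup (Fin n) ℂ) (S : Sym n), LGr.param A S = L := by
  obtain ⟨Q, h⟩ := L.exists_act_std_eq
  exact ⟨toSymplectic Q, 0, h⟩

theorem LGr.isEmbedding_emb : Topology.IsEmbedding (LGr.emb (n := n)) := by
  refine isEmbedding_of_eventually_leftInverse LGr.continuous_emb
    (fun _ _ h => LGr.toMat_injective h) fun L => ?_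
  obtain ⟨A, S, rfl⟩ := L.exists_param_eq
  have hmem := entries_toMat_param_mem_paramTarget A S
  refine ⟨fun X => LGr.param A (paramInv A (Matrix.of X)),
    (LGr.continuous_param A).continuousAt.comp (contDiffAt_paramInv hmem).continuousAt, ?_⟩
  filter_upwards [(isOpen_paramTarget A).mem_nhds hmem] with _ hX L hL
  subst hL
  exact param_paramInv hX

theorem LGr.range_emb : Set.range (LGr.emb (n := n)) = {X | Matrix.of X ∈ QQL n} := by
  rw [← LGr.range_toMat]
  rfl

theorem LGr.isLocalDiffeomorph_param {k : ℕ} [ChartedSpace (EuclideanSpace ℝ (Fin k)) (LGr n)]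
    (h : Manifold.IsSmoothEmbedding (𝓡 k) 𝓘(ℝ, Entries n) ∞ (LGr.emb (n := n))) :
    IsLocalDiffeomorph 𝓘(ℝ, Sym n) (𝓡 k) ∞ (LGr.param A) := by
  let e : PartialDiffeomorph 𝓘(ℝ, Sym n) (𝓡 k) (Sym n) (LGr n) ∞ :=
    { toFun := LGr.param A
      invFun := fun L => paramInv A L.toMat
      source := Set.univ
      target := LGr.emb ⁻¹' paramTarget A
      map_source' := fun S _ => entries_toMat_param_mem_paramTarget A S
      map_target' := fun _ _ => Set.mem_univ _
      left_inv' := fun S _ => paramInv_toMat_param A S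
      right_inv' := fun _ hL => param_paramInv hL
      open_source := isOpen_univ
      open_target := (isOpen_paramTarget A).preimage LGr.continuous_emb
      contMDiffOn_toFun := ((ContMDiff.iff_comp_isImmersion h.isImmersion).2
        ⟨LGr.continuous_param A, (LGr.contDiff_emb_param A).contMDiff⟩).contMDiffOn
      contMDiffOn_invFun := fun L hL =>
        ((contDiffAt_paramInv hL).contMDiffAt.comp L
          h.isImmersion.contMDiff.contMDiffAt).contMDiffWithinAt }
  exact fun S => ⟨e, Set.mem_univ S, fun _ _ => rfl⟩

end ComplexLagrangian

section CayleyOrbits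

variable {𝕜 𝕂 m E M G : Type*} [NontriviallyNormedField 𝕜] [CompleteSpace 𝕜]
  [NontriviallyNormedField 𝕂] [NormedAlgebra 𝕜 𝕂] [FiniteDimensional 𝕜 𝕂] [CharZero 𝕂]
  [Fintype m] [DecidableEq m] [NormedAddCommGroup E] [NormedSpace 𝕜 E] [FiniteDimensional 𝕜 E]
  [TopologicalSpace M] [Group G]

theorem inv_mul_mul_mem_range_mul_inv_iff {R : Type*} [Monoid R] (f g : G →* Rˣ) (a : G) (x : R) :
    (f a)⁻¹.1 * x * (g a) ∈ Set.range (fun b => (f b * (g b)⁻¹).1) ↔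
      x ∈ Set.range fun b => (f b * (g b)⁻¹).1 := by
  constructor
  · rintro ⟨b, hb⟩
    refine ⟨a * b, ?_⟩
    have hx : x = (f a).1 * ((f a)⁻¹.1 * x * (g a)) * (g a)⁻¹.1 := by simp [mul_assoc]
    rw [hx, ← hb]
    simp [mul_assoc]
  · rintro ⟨b, rfl⟩
    exact ⟨a⁻¹ * b, by simp [mul_assoc]⟩

/-- The orbit `{f a (g a)⁻¹}` of `1` is homogeneous, so that a Cayley chart at `1` which straightens
it to a linear subspace suffices to make it a submanifold. -/
theorem exists_isSmoothEmbedding_of_cayley (k : WithTop ℕ∞) (f g : G →* (Matrix m m 𝕂)ˣ)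
    {W : Submodule 𝕜 (m → m → 𝕂)} (hW : Module.finrank 𝕜 W = Module.finrank 𝕜 E)
    (hcayley : ∀ Z : Matrix m m 𝕂, IsUnit (1 + Z) →
      (Matrix.of.symm (cayley Z) ∈ W ↔ Z ∈ Set.range fun a => (f a * (g a)⁻¹).1))
    {j : M → m → m → 𝕂} (hj : Topology.IsEmbedding j)
    (hrange : ∀ X, X ∈ Set.range j ↔ Matrix.of X ∈ Set.range fun a => (f a * (g a)⁻¹).1) :
    ∃ _ : ChartedSpace E M, IsManifold 𝓘(𝕜, E) k M ∧
      Manifold.IsSmoothEmbedding 𝓘(𝕜, E) 𝓘(𝕜, m → m → 𝕂) k j := by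
  obtain ⟨F, e, he⟩ := exists_splitting_of_finrank_eq W hW
  refine exists_isSmoothEmbedding_of_sliceCharts (g := e) hj fun x => ?_
  obtain ⟨a, ha⟩ := (hrange _).1 (Set.mem_range_self x)
  refine ⟨⟨cayleyChart (f a) (g a)⁻¹, contDiffOn_cayleyChart _ _, contDiffOn_cayleyChart_symm _ _,
    fun X hX => ?_⟩, ?_⟩
  · rw [← he]
    refine (hrange X).trans (Iff.trans ?_ (hcayley _ hX).symm)
    rw [inv_inv, inv_mul_mul_mem_range_mul_inv_iff]
  · change IsUnit (1 + (f a)⁻¹.1 * Matrix.of (j x) * (g a)⁻¹⁻¹.1)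
    simpa [← ha, one_add_one_eq_two, mul_assoc] using isUnit_two_matrix

end CayleyOrbits

namespace ComplexLagrangian

variable {n : ℕ}

/-- The inclusion of `Sp(n)` in the group of invertible matrices. -/
def spUnits (n : ℕ) : Sp n →* (BlockMat n)ˣ := (Units.map (Sp n).subtype).comp toUnits.toMonoidHom

theorem spUnits_mul_inv_involution (Q : Sp n) :
    (spUnits n Q * (spUnits n (involution n Q))⁻¹).1 = Q.1 * lagAdj Q.1 := by
  rw [mul_lagAdj_coe, ← map_inv, ← map_mul]
  rfl

theorem range_mul_lagAdj : (Set.range fun Q : Sp n => Q.1 * lagAdj Q.1) = QQL n :=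
  Set.ext fun _ => ⟨fun ⟨Q, hQ⟩ => ⟨Q.1, Q.2, hQ.symm⟩, fun ⟨Q, hQ, hX⟩ => ⟨⟨Q, hQ⟩, hX.symm⟩⟩

section SmoothStructures

variable {M : Type*} [TopologicalSpace M] {j : M → Entries n}

theorem exists_isSmoothEmbedding_of_range_eq_Sp (hj : Topology.IsEmbedding j)
    (hrange : Set.range j = {X | Matrix.of X ∈ Sp n}) :
    ∃ _ : ChartedSpace (EuclideanSpace ℝ (Fin (n * (2 * n + 1)))) M,
      IsManifold (𝓡 (n * (2 * n + 1))) ∞ M ∧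
        Manifold.IsSmoothEmbedding (𝓡 (n * (2 * n + 1))) 𝓘(ℝ, Entries n) ∞ j := by
  have hSp : (Set.range fun Q : Sp n => (spUnits n Q * ((1 : Sp n →* (BlockMat n)ˣ) Q)⁻¹).1) =
      Sp n := by
    simp only [MonoidHom.one_apply, inv_one, mul_one]
    exact Subtype.range_coe
  refine exists_isSmoothEmbedding_of_cayley ∞ (spUnits n) 1 (W := spLie n) ?_ ?_ hj ?_
  · rw [finrank_spLie, finrank_euclideanSpace_fin]
  · rw [hSp]
    exact fun Z hZ => cayley_mem_spLie_iff hZ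
  · rw [hSp, hrange]
    exact fun X => Iff.rfl

theorem exists_isSmoothEmbedding_of_range_eq_QQL (hj : Topology.IsEmbedding j)
    (hrange : Set.range j = {X | Matrix.of X ∈ QQL n}) :
    ∃ _ : ChartedSpace (EuclideanSpace ℝ (Fin (n * (n + 1)))) M,
      IsManifold (𝓡 (n * (n + 1))) ∞ M ∧
        Manifold.IsSmoothEmbedding (𝓡 (n * (n + 1))) 𝓘(ℝ, Entries n) ∞ j := by
  refine exists_isSmoothEmbedding_of_cayley ∞ (spUnits n) ((spUnits n).comp (involution n))
    (W := symLie n) ?_ ?_ hj ?_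
  · rw [finrank_symLie, finrank_euclideanSpace_fin]
  · simp only [MonoidHom.comp_apply, spUnits_mul_inv_involution, range_mul_lagAdj]
    exact fun Z hZ => (cayley_mem_symLie_iff hZ).trans mem_QQL_iff.symm
  · simp only [MonoidHom.comp_apply, spUnits_mul_inv_involution, range_mul_lagAdj, hrange]
    exact fun X => Iff.rfl

end SmoothStructures

theorem isEmbedding_entries_coe (S : Set (BlockMat n)) :
    Topology.IsEmbedding fun X : S => entries X.1 :=
  Topology.IsEmbedding.subtypeVal

theorem range_entries_coe (S : Set (BlockMat n)) :
    (Set.range fun X : S => entries X.1) = {X | Matrix.of X ∈ S} :=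
  Subtype.range_coe

theorem isClosed_Sp : IsClosed {X : Entries n | Matrix.of X ∈ Sp n} := by
  simp only [mem_Sp_iff]
  have hof : Continuous fun X : Entries n => (Matrix.of X : BlockMat n) := continuous_id
  exact (isClosed_eq ((hof.matrix_conjTranspose.matrix_mul continuous_const).matrix_mul hof)
    continuous_const).inter (isClosed_eq
      ((hof.matrix_transpose.matrix_mul continuous_const).matrix_mul hof) continuous_const)

instance : CompactSpace (Sp n) := by
  have hbounded : Bornology.IsBounded {X : Entries n | Matrix.of X ∈ Sp n} :=
    isBounded_iff_forall_norm_le.2 ⟨1, fun X hX =>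
      (pi_norm_le_iff_of_nonneg zero_le_one).2 fun i =>
        (pi_norm_le_iff_of_nonneg zero_le_one).2 fun j => entry_norm_bound_of_unitary hX.1 i j⟩
  exact isCompact_iff_compactSpace.1 (Metric.isCompact_of_isClosed_isBounded isClosed_Sp hbounded)

/-- The Cartan embedding `[Q] ↦ Q Q^L` of `Sp(n)/U(n)` in the space of matrices. -/
def quotEmb (n : ℕ) (q : Sp n ⧸ U n) : Entries n :=
  Quotient.liftOn' q (fun Q => entries (Q.1 * lagAdj Q.1)) fun _ _ h =>
    mul_lagAdj_eq_iff.2 (QuotientGroup.leftRel_apply.1 h)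

theorem quotEmb_mk (Q : Sp n) : quotEmb n (QuotientGroup.mk Q) = entries (Q.1 * lagAdj Q.1) := rfl

theorem contDiff_mul_lagAdj :
    ContDiff ℝ ∞ fun X : Entries n => entries (Matrix.of X * lagAdj (Matrix.of X)) :=
  contDiff_iff_contDiffAt.2 fun _ => (EntrywiseContDiffAt.of_id.mul
    (((EntrywiseContDiffAt.const _).mul EntrywiseContDiffAt.of_id.conjTranspose).mul
      (.const _))).contDiffAt

theorem continuous_quotEmb : Continuous (quotEmb n) :=
  Continuous.quotient_liftOn' (contDiff_mul_lagAdj.continuous.comp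
    (isEmbedding_entries_coe (Sp n : Set (BlockMat n))).continuous) _

theorem quotEmb_injective : Function.Injective (quotEmb n) := fun q r => by
  induction q using QuotientGroup.induction_on
  induction r using QuotientGroup.induction_on
  exact fun h => QuotientGroup.eq.2 (mul_lagAdj_eq_iff.1 h)

theorem isEmbedding_quotEmb : Topology.IsEmbedding (quotEmb n) :=
  (continuous_quotEmb.isClosedEmbedding quotEmb_injective).isEmbedding

theorem range_quotEmb : Set.range (quotEmb n) = {X | Matrix.of X ∈ QQL n} := by
  rw [← range_mul_lagAdj]
  exact (QuotientGroup.mk_surjective.range_comp _).symm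

end ComplexLagrangian

open scoped ComplexOrder in
theorem isUnit_one_add_of_conjTranspose_eq_neg {𝕜 m : Type*} [RCLike 𝕜] [Fintype m]
    [DecidableEq m] {Z : Matrix m m 𝕜} (h : Zᴴ = -Z) : IsUnit (1 + Z) := by
  have hmul : (1 + Z)ᴴ * (1 + Z) = 1 + Zᴴ * Z := by
    rw [Matrix.conjTranspose_add, h, Matrix.conjTranspose_one]
    noncomm_ring
  have hpos := Matrix.PosDef.one.add_posSemidef (Matrix.posSemidef_conjTranspose_mul_self Z)
  rw [← hmul] at hpos
  have hdet := hpos.isUnit.map (Matrix.detMonoidHom (R := 𝕜) (n := m))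
  rw [map_mul] at hdet
  exact (Matrix.isUnit_iff_isUnit_det _).2 (isUnit_of_mul_isUnit_right hdet)

theorem fderiv_zero_apply_of_eq_add_smul {𝕜 X Y : Type*} [NontriviallyNormedField 𝕜]
    [NormedAddCommGroup X] [NormedSpace 𝕜 X] [NormedAddCommGroup Y] [NormedSpace 𝕜 Y]
    {F : X → Y} {z : X} {B : 𝕜 → Y} {c : Y} (hF : DifferentiableAt 𝕜 F 0)
    (hB : ContinuousAt B 0) (h : ∀ t : 𝕜, F (t • z) = c + t • B t) : fderiv 𝕜 F 0 z = B 0 := by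
  have hderiv : HasLineDerivAt 𝕜 F (B 0) 0 z := by
    refine hasDerivAt_iff_tendsto_slope_zero.2 ?_
    refine (hB.tendsto.mono_left nhdsWithin_le_nhds).congr' ?_
    filter_upwards [self_mem_nhdsWithin] with t ht
    rw [zero_add, zero_add, zero_add, h, h, zero_smul, add_zero, add_sub_cancel_left,
      inv_smul_smul₀ ht]
  rw [← hF.lineDeriv_eq_fderiv, hderiv.lineDeriv]

namespace ComplexLagrangian

variable {n : ℕ}

theorem isUnit_one_add_of_entries_mem_spLie {Z : BlockMat n} (h : entries Z ∈ spLie n) :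
    IsUnit (1 + Z) :=
  isUnit_one_add_of_conjTranspose_eq_neg (entries_mem_spLie_iff.1 h).1

theorem cayley_mem_Sp {Z : BlockMat n} (h : entries Z ∈ spLie n) : cayley Z ∈ Sp n := by
  have hZ := isUnit_one_add_of_entries_mem_spLie h
  rwa [← cayley_mem_spLie_iff (isUnit_one_add_cayley isUnit_two_matrix hZ),
    cayley_cayley isUnit_two_matrix hZ]

/-- The map `Z ↦ Q cayley(Z)`, which parametrizes a submanifold of `Sp(n)` through `Q` transverse
to the fibre `Q U(n)` of the projection to `Sp(n)/U(n)`. -/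
noncomputable def transversal (Q : Sp n) (Z : symLie n) : Sp n :=
  Q * ⟨cayley (Matrix.of Z.1), cayley_mem_Sp Z.2.1⟩

theorem transversal_zero (Q : Sp n) : transversal Q 0 = Q :=
  mul_eq_left.2 (Subtype.ext cayley_zero)

theorem contDiff_transversal (Q : Sp n) :
    ContDiff ℝ ∞ fun Z : symLie n => entries (transversal Q Z).1 :=
  contDiff_iff_contDiffAt.2 fun Z => ((EntrywiseContDiffAt.const _).mul
    ((EntrywiseContDiffAt.of_contDiffAt (symLie n).subtypeL.contDiff.contDiffAt).cayley
      (isUnit_one_add_of_entries_mem_spLie Z.2.1))).contDiffAt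

open scoped Ring in
theorem quotEmb_mk_transversal (Q : Sp n) (Z : symLie n) :
    quotEmb n (QuotientGroup.mk (transversal Q Z)) =
      entries (Q.1 * (1 - 4 * (Matrix.of Z.1 *
        ((1 + Matrix.of Z.1)⁻¹ʳ * (1 + Matrix.of Z.1)⁻¹ʳ))) * lagAdj Q.1) := by
  have hZ : IsUnit (1 + Matrix.of Z.1 : BlockMat n) := isUnit_one_add_of_entries_mem_spLie Z.2.1
  have hL : lagAdj (cayley (Matrix.of Z.1 : BlockMat n)) = cayley (Matrix.of Z.1) := by
    rw [lagAdj_cayley hZ]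
    exact congrArg cayley Z.2.2.symm
  rw [quotEmb_mk, ← cayley_mul_cayley hZ]
  change entries (Q.1 * cayley (Matrix.of Z.1) * lagAdj (Q.1 * cayley (Matrix.of Z.1))) = _
  rw [lagAdj_mul, hL]
  simp only [mul_assoc]

theorem contDiff_quotEmb_mk_transversal (Q : Sp n) :
    ContDiff ℝ ∞ (quotEmb n ∘ QuotientGroup.mk ∘ transversal Q) :=
  contDiff_mul_lagAdj.comp (contDiff_transversal Q)

open scoped Ring in
theorem fderiv_quotEmb_mk_transversal (Q : Sp n) (Z : symLie n) :
    fderiv ℝ (quotEmb n ∘ QuotientGroup.mk ∘ transversal Q) 0 Z =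
      entries (-(Q.1 * (4 * Matrix.of Z.1) * lagAdj Q.1)) := by
  let B : ℝ → BlockMat n := fun t => -1 * (Q.1 * (4 * (Matrix.of Z.1 *
    ((1 + t • Matrix.of Z.1)⁻¹ * (1 + t • Matrix.of Z.1)⁻¹))) * lagAdj Q.1)
  have hB : EntrywiseContDiffAt ℝ 0 B 0 := by
    have hsmul : EntrywiseContDiffAt ℝ 0 (fun t : ℝ => t • (Matrix.of Z.1 : BlockMat n)) 0 :=
      fun _ _ => contDiffAt_id.smul contDiffAt_const
    have hinv : EntrywiseContDiffAt ℝ 0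
        (fun t : ℝ => (1 + t • Matrix.of Z.1 : BlockMat n)⁻¹) 0 :=
      ((EntrywiseContDiffAt.const _).add hsmul).inv (by rw [zero_smul, add_zero]; exact isUnit_one)
    exact (EntrywiseContDiffAt.const _).mul (((EntrywiseContDiffAt.const _).mul
      ((EntrywiseContDiffAt.const _).mul ((EntrywiseContDiffAt.const _).mul
        (hinv.mul hinv)))).mul (EntrywiseContDiffAt.const _))
  have hexpand (t : ℝ) : (quotEmb n ∘ QuotientGroup.mk ∘ transversal Q) (t • Z) =
      entries (Q.1 * lagAdj Q.1) + t • entries (B t) := by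
    refine (quotEmb_mk_transversal Q (t • Z)).trans (Matrix.of.injective ?_)
    change Q.1 * (1 - 4 * (t • Matrix.of Z.1 *
        ((1 + t • Matrix.of Z.1)⁻¹ʳ * (1 + t • Matrix.of Z.1)⁻¹ʳ))) * lagAdj Q.1 =
      Q.1 * lagAdj Q.1 + t • B t
    rw [mul_sub, sub_mul, mul_one, sub_eq_add_neg]
    simp only [B, Matrix.nonsing_inv_eq_ringInverse, smul_mul_assoc, mul_smul_comm, neg_mul,
      one_mul, smul_neg]
  rw [fderiv_zero_apply_of_eq_add_smul
    ((contDiff_quotEmb_mk_transversal Q).differentiable (by simp) 0)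
    hB.contDiffAt.continuousAt hexpand]
  refine congrArg entries ?_
  simp only [B, zero_smul, add_zero, inv_one, mul_one, neg_mul, one_mul]

theorem injective_fderiv_quotEmb_mk_transversal (Q : Sp n) : Function.Injective
    (fderiv ℝ (quotEmb n ∘ QuotientGroup.mk ∘ transversal Q) 0) := by
  rw [injective_iff_map_eq_zero]
  intro Z hZ
  rw [fderiv_quotEmb_mk_transversal] at hZ
  have hQZ : Q.1 * (4 * Matrix.of Z.1) * lagAdj Q.1 = 0 :=
    neg_eq_zero.1 (Matrix.of.symm.injective hZ)
  have hQ : IsUnit Q.1 := (spUnits n Q).isUnit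
  have hL : IsUnit (lagAdj Q.1) := lagAdj_coe Q ▸ (spUnits n (involution n Q)⁻¹).isUnit
  have h4 : IsUnit (4 : BlockMat n) := by
    convert (isUnit_two_matrix (𝕂 := ℂ) (m := Fin n ⊕ Fin n)).mul isUnit_two_matrix using 1
    norm_num
  rw [hL.mul_left_eq_zero, hQ.mul_right_eq_zero, h4.mul_right_eq_zero] at hQZ
  exact Subtype.ext (Matrix.of.injective hQZ)

section Submersion

variable {E E' H H' : Type*} [NormedAddCommGroup E] [NormedSpace ℝ E]
  [NormedAddCommGroup E'] [NormedSpace ℝ E'] [TopologicalSpace H] [TopologicalSpace H']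
  {I : ModelWithCorners ℝ E H} {I' : ModelWithCorners ℝ E' H'}
  [ChartedSpace H (Sp n)] [ChartedSpace H' (Sp n ⧸ U n)]

theorem contMDiff_mk
    (h : Manifold.IsSmoothEmbedding I 𝓘(ℝ, Entries n) ∞ fun Q : Sp n => entries Q.1)
    (h' : Manifold.IsSmoothEmbedding I' 𝓘(ℝ, Entries n) ∞ (quotEmb n)) :
    ContMDiff I I' ∞ (QuotientGroup.mk : Sp n → Sp n ⧸ U n) :=
  contMDiff_of_comp_isSmoothEmbedding h' (contDiff_mul_lagAdj.contMDiff.comp h.contMDiff)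

theorem surjective_mfderiv_mk [FiniteDimensional ℝ E']
    (h : Manifold.IsSmoothEmbedding I 𝓘(ℝ, Entries n) ∞ fun Q : Sp n => entries Q.1)
    (h' : Manifold.IsSmoothEmbedding I' 𝓘(ℝ, Entries n) ∞ (quotEmb n))
    (hdim : Module.finrank ℝ E' = n * (n + 1)) (Q : Sp n) :
    Function.Surjective (mfderiv I I' (QuotientGroup.mk : Sp n → Sp n ⧸ U n) Q) := by
  have hsmooth : (∞ : WithTop ℕ∞) ≠ 0 := by simp
  have htransversal : ContMDiff 𝓘(ℝ, symLie n) I ∞ (transversal Q) :=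
    contMDiff_of_comp_isSmoothEmbedding h (contDiff_transversal Q).contMDiff
  have hsurj := mfderiv_surjective_of_injective_fderiv_comp
    (h'.contMDiff.mdifferentiable hsmooth _) ((contMDiff_mk h h').mdifferentiable hsmooth _)
    (htransversal.mdifferentiable hsmooth 0) (injective_fderiv_quotEmb_mk_transversal Q)
    (finrank_symLie.trans hdim.symm)
  rwa [transversal_zero] at hsurj

end Submersion

section Diffeomorphisms

variable {n : ℕ} {E E' H H' : Type*} [NormedAddCommGroup E] [NormedSpace ℝ E]
  [NormedAddCommGroup E'] [NormedSpace ℝ E'] [TopologicalSpace H] [TopologicalSpace H']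
  {I : ModelWithCorners ℝ E H} {I' : ModelWithCorners ℝ E' H'} [ChartedSpace H' (Sp n ⧸ U n)]

theorem exists_diffeomorph_LGr_quotient [ChartedSpace H (LGr n)]
    (h : Manifold.IsSmoothEmbedding I 𝓘(ℝ, Entries n) ∞ (LGr.emb (n := n)))
    (h' : Manifold.IsSmoothEmbedding I' 𝓘(ℝ, Entries n) ∞ (quotEmb n)) :
    ∃ Φ : LGr n ≃ₘ^∞⟮I, I'⟯ (Sp n ⧸ U n),
      (∀ Q : Sp n, Φ (LGr.act (toSymplectic Q) (LGr.std n)) = QuotientGroup.mk Q) ∧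
      ∀ (A : Sp n) (L : LGr n), Φ (LGr.act (toSymplectic A) L) = A • Φ L := by
  obtain ⟨Φ, hΦ⟩ := exists_diffeomorph_of_range_eq h h' (LGr.range_emb.trans range_quotEmb.symm)
  have hstd (Q : Sp n) : Φ (LGr.act (toSymplectic Q) (LGr.std n)) = QuotientGroup.mk Q :=
    quotEmb_injective ((hΦ _).trans (congrArg entries (LGr.toMat_act_std Q)))
  refine ⟨Φ, hstd, fun A L => ?_⟩
  obtain ⟨Q, rfl⟩ := L.exists_act_std_eq
  rw [LGr.act_act, hstd, hstd]
  rfl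

theorem exists_diffeomorph_quotient_QQL [ChartedSpace H (QQL n)]
    (h' : Manifold.IsSmoothEmbedding I' 𝓘(ℝ, Entries n) ∞ (quotEmb n))
    (h : Manifold.IsSmoothEmbedding I 𝓘(ℝ, Entries n) ∞ fun X : QQL n => entries X.1) :
    ∃ Ψ : (Sp n ⧸ U n) ≃ₘ^∞⟮I', I⟯ (QQL n),
      (∀ Q : Sp n, (Ψ (QuotientGroup.mk Q)).1 = Q.1 * lagAdj Q.1) ∧
      ∀ (A : Sp n) (q : Sp n ⧸ U n), (Ψ (A • q)).1 = A.1 * (Ψ q).1 * lagAdj A.1 := by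
  obtain ⟨Ψ, hΨ⟩ := exists_diffeomorph_of_range_eq h' h
    (range_quotEmb.trans (range_entries_coe (QQL n)).symm)
  have hmk (Q : Sp n) : (Ψ (QuotientGroup.mk Q)).1 = Q.1 * lagAdj Q.1 := hΨ _
  refine ⟨Ψ, hmk, fun A q => ?_⟩
  induction q using QuotientGroup.induction_on with
  | H Q =>
    rw [MulAction.Quotient.smul_mk, hmk, hmk, smul_eq_mul, Submonoid.coe_mul, lagAdj_mul]
    simp only [mul_assoc]

end Diffeomorphisms

end ComplexLagrangian

open ComplexLagrangian in
theorem mainTheorem7 (n : ℕ) (hn : 0 < n) :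
    (∃ (_ : ChartedSpace (EuclideanSpace ℝ (Fin (n * (2 * n + 1)))) (Sp n))
       (_ : ChartedSpace (EuclideanSpace ℝ (Fin (n * (n + 1)))) (LGr n))
       (_ : ChartedSpace (EuclideanSpace ℝ (Fin (n * (n + 1)))) (Sp n ⧸ U n))
       (_ : ChartedSpace (EuclideanSpace ℝ (Fin (n * (n + 1)))) (QQL n)),
      -- `Sp(n)` with its smooth structure as a submanifold of the space of matrices
      (IsManifold (𝓡 (n * (2 * n + 1))) ∞ (Sp n) ∧
        Manifold.IsSmoothEmbedding (𝓡 (n * (2 * n + 1))) 𝓘(ℝ, Entries n) ∞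
          (fun Q : Sp n => entries (Q : BlockMat n))) ∧
      -- `LGr(ℂ²ⁿ)` with the smooth structure given by its affine parametrizations
      (IsManifold (𝓡 (n * (n + 1))) ∞ (LGr n) ∧
        ∀ A : Matrix.symplecticGroup (Fin n) ℂ,
          IsLocalDiffeomorph 𝓘(ℝ, Sym n) (𝓡 (n * (n + 1))) ∞ (LGr.param A)) ∧
      -- `Sp(n)/U(n)` with the smooth structure for which the projection is a submersion
      (IsManifold (𝓡 (n * (n + 1))) ∞ (Sp n ⧸ U n) ∧
        ContMDiff (𝓡 (n * (2 * n + 1))) (𝓡 (n * (n + 1))) ∞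
          (QuotientGroup.mk : Sp n → Sp n ⧸ U n) ∧
        ∀ Q : Sp n, Function.Surjective
          (mfderiv (𝓡 (n * (2 * n + 1))) (𝓡 (n * (n + 1)))
            (QuotientGroup.mk : Sp n → Sp n ⧸ U n) Q)) ∧
      -- `{Q Q^L}` as a submanifold of the space of matrices
      (IsManifold (𝓡 (n * (n + 1))) ∞ (QQL n) ∧
        Manifold.IsSmoothEmbedding (𝓡 (n * (n + 1))) 𝓘(ℝ, Entries n) ∞
          (fun X : QQL n => entries (X : BlockMat n))) ∧
      -- the two equivariant diffeomorphisms
      (∃ Φ : LGr n ≃ₘ^∞⟮𝓡 (n * (n + 1)), 𝓡 (n * (n + 1))⟯ (Sp n ⧸ U n),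
        (∀ Q : Sp n, Φ (LGr.act (toSymplectic Q) (LGr.std n)) = QuotientGroup.mk Q) ∧
        ∀ (A : Sp n) (L : LGr n), Φ (LGr.act (toSymplectic A) L) = A • Φ L) ∧
      (∃ Ψ : (Sp n ⧸ U n) ≃ₘ^∞⟮𝓡 (n * (n + 1)), 𝓡 (n * (n + 1))⟯ (QQL n),
        (∀ Q : Sp n, (Ψ (QuotientGroup.mk Q) : BlockMat n) = (Q : BlockMat n) * lagAdj (Q : BlockMat n)) ∧
        ∀ (A : Sp n) (q : Sp n ⧸ U n),
          (Ψ (A • q) : BlockMat n) = (A : BlockMat n) * (Ψ q : BlockMat n) * lagAdj (A : BlockMat n))) ∧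
    QQL n = (Sp n : Set (BlockMat n)) ∩ (V2 n : Set (BlockMat n)) ∧
    (Sp n : Set (BlockMat n)) ∩ (V2 n : Set (BlockMat n)) = {X | X ∈ Sp n ∧ X = lagAdj X} := by
  refine ⟨?_, Set.ext fun _ => mem_QQL_iff, rfl⟩
  obtain ⟨c₁, m₁, i₁⟩ := exists_isSmoothEmbedding_of_range_eq_Sp
    (isEmbedding_entries_coe (Sp n : Set (BlockMat n))) (range_entries_coe _)
  obtain ⟨c₂, m₂, i₂⟩ := exists_isSmoothEmbedding_of_range_eq_QQL LGr.isEmbedding_emb LGr.range_emb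
  obtain ⟨c₃, m₃, i₃⟩ := exists_isSmoothEmbedding_of_range_eq_QQL
    (n := n) isEmbedding_quotEmb range_quotEmb
  obtain ⟨c₄, m₄, i₄⟩ := exists_isSmoothEmbedding_of_range_eq_QQL
    (isEmbedding_entries_coe (QQL n)) (range_entries_coe _)
  exact ⟨c₁, c₂, c₃, c₄, ⟨m₁, i₁⟩, ⟨m₂, fun A => LGr.isLocalDiffeomorph_param A i₂⟩,
    ⟨m₃, contMDiff_mk i₁ i₃, surjective_mfderiv_mk i₁ i₃ finrank_euclideanSpace_fin⟩, ⟨m₄, i₄⟩,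
    exists_diffeomorph_LGr_quotient i₂ i₃, exists_diffeomorph_quotient_QQL i₃ i₄⟩
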